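/- Let $X$ be a finite dimensional real Banach space with a Haar measure $\lambda$, let $Y$ be a real Banach space with the Radon–Nikodým property, and let $Q\ge 1$ be an integer. For a metric space $(Z,d)$ let $\mathscr{Q}_Q(Z)$ be the set of unordered $Q$-tuples $[\![z_1,\ldots,z_Q]\!]$ of elements of $Z$, with the metric $$\mathscr{G}\big([\![z_1,\ldots,z_Q]\!],[\![z'_1,\ldots,z'_Q]\!]\big)=\min_{\sigma\in S_Q}\Big(\sum_{i=1}^Q d(z_i,z'_{\sigma(i)})^2\Big)^{1/2}.$$ A map $f:X\to\mathscr{Q}_Q(Y)$ is approximately differentiable at $a\in X$ if there are affine maps $A_1,\ldots,A_Q:X\to Y$ such that, for every $\varepsilon>0$, the set $\{x:\mathscr{G}(f(x),[\![A_1(x),\ldots,A_Q(x)]\!])>\varepsilon\|x-a\|\}$ has $\lambda$-density $0$ at $a$. In that case the unordered tuple $Af(a)=[\![A_1,\ldots,A_Q]\!]$ is unique; one writes $Af(a)(x)=[\![A_1(x),\ldots,A_Q(x)]\!]$ and $Df(a)=[\![L_1,\ldots,L_Q]\!]\in\mathscr{Q}_Q(\mathrm{Hom}(X,Y))$, where $L_i=A_i-A_i(0)$,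 and, with $\|\cdot\|$ the operator norm on $\mathrm{Hom}(X,Y)$, $$|Df(a)|=\Big(\sum_{i=1}^Q\|L_i\|^2\Big)^{1/2}.$$ One says that $f$ is unambiguously approximately differentiable at $a$ if moreover $A_i(a)=A_j(a)$ implies $L_i=L_j$, for all $i,j$. Let $f:X\to\mathscr{Q}_Q(Y)$ be Lipschitz, with Lipschitz constant $\mathrm{Lip}\,f$. Then: (A) For $\lambda$-almost every $a\in X$, $f$ is unambiguously approximately differentiable at $a$, and $Af(a)(a)=f(a)$. (B) The set of points of approximate differentiability of $f$ is a Borel set, and the map $x\mapsto Df(x)$, with values in $\mathscr{Q}_Q(\mathrm{Hom}(X,Y))$, is Borel measurable on it. (C) If $f$ is approximately differentiable at $a\in X$, then $$\lim_{x\to a}\frac{\mathscr{G}(f(x),Af(a)(x))}{\|x-a\|}=0\qquad\text{and}\qquad |Df(a)|\le\sqrt{Q}\,\mathrm{Lip}\,f.$$ (D) For every injective Lipschitz curve $\gamma:[0,1]\to X$ such that, for almost every $t\in[0,1]$, $\|\gamma'(t)\|=1$ and $f$ is approximately differentiable at $\gamma(t)$, the function $x\mapsto|Df(x)|$ is integrable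 on $\gamma([0,1])$ with respect to the one-dimensional Hausdorff measure $\mathscr{H}^1$, and $$\mathscr{G}\big(f(\gamma(1)),f(\gamma(0))\big)\le\int_{\gamma([0,1])}|Df(x)|\,d\mathscr{H}^1(x).$$ -/

import Mathlib

open MeasureTheory Filter Topology
open scoped NNReal ENNReal

namespace QValued

/-! ### Unordered `Q`-tuples and the metric `𝒢 = 𝒢₂`

Unordered `Q`-tuples of elements of `Y` are the elements of `Sym Y Q`. -/

section Tuples

variable {Y : Type*} {Q : ℕ}

/-- The unordered tuple `⟦y₁, …, y_Q⟧` of a family `y`. -/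
def ofFn (y : Fin Q → Y) : Sym Y Q :=
  Sym.mk (Finset.univ.val.map y) (by simp)

theorem exists_ofFn_eq (v : Sym Y Q) : ∃ y : Fin Q → Y, ofFn y = v := by
  obtain ⟨m, hm⟩ := v
  induction m using Quotient.inductionOn with
  | h l =>
    have hl : l.length = Q := by simpa using hm
    subst hl
    refine ⟨l.get, Sym.ext ?_⟩
    simp [ofFn, Sym.mk]

theorem ofFn_eq_ofFn_iff {y z : Fin Q → Y} :
    ofFn y = ofFn z ↔ ∃ σ : Equiv.Perm (Fin Q), y = z ∘ σ := by
  classical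
  have hc : ∀ (x : Fin Q → Y) (b : Y),
      (Finset.univ.val.map x).count b = Fintype.card {i // x i = b} := by
    intro x b
    rw [Multiset.count_map, Fintype.card_subtype, Finset.card_def, Finset.filter_val]
    simp only [eq_comm]
  rw [← Sym.coe_inj]
  change Finset.univ.val.map y = Finset.univ.val.map z ↔ _
  constructor
  · intro h
    have e : ∀ b, Nonempty ({i // y i = b} ≃ {i // z i = b}) := fun b =>
      Fintype.card_eq.1 (by rw [← hc, ← hc, h])
    exact ⟨Equiv.ofFiberEquiv fun b => Classical.choice (e b),
      funext fun i => (Equiv.ofFiberEquiv_map _ i).symm⟩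
  · rintro ⟨σ, rfl⟩
    ext b
    rw [hc, hc]
    exact Fintype.card_congr (σ.subtypeEquiv fun i => Iff.rfl)

/-- A numbering of an unordered tuple. -/
noncomputable def numbering (v : Sym Y Q) : Fin Q → Y := (exists_ofFn_eq v).choose

theorem ofFn_numbering (v : Sym Y Q) : ofFn (numbering v) = v := (exists_ofFn_eq v).choose_spec

/-- `𝒢(⟦y₁, …, y_Q⟧, ⟦z₁, …, z_Q⟧) = min_σ √(∑ᵢ d(yᵢ, z_{σ i})²)`, the minimum being over all
permutations `σ`. It does not depend on the numberings: see `gDist_ofFn`. -/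
noncomputable def gDist [MetricSpace Y] (v w : Sym Y Q) : ℝ :=
  ⨅ σ : Equiv.Perm (Fin Q), √(∑ i, dist (numbering v i) (numbering w (σ i)) ^ 2)

theorem gDist_ofFn [MetricSpace Y] (y z : Fin Q → Y) :
    gDist (ofFn y) (ofFn z) =
      ⨅ σ : Equiv.Perm (Fin Q), √(∑ i, dist (y i) (z (σ i)) ^ 2) := by
  obtain ⟨τ, hτ⟩ := ofFn_eq_ofFn_iff.1 (ofFn_numbering (ofFn y))
  obtain ⟨ρ, hρ⟩ := ofFn_eq_ofFn_iff.1 (ofFn_numbering (ofFn z))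
  rw [gDist, hτ, hρ]
  refine Equiv.iInf_congr ((Equiv.mulLeft ρ).trans (Equiv.mulRight τ⁻¹)) fun σ => ?_
  congr 1
  refine (Equiv.sum_comp τ fun i => _).symm.trans ?_
  simp

theorem gDist_ofFn_le [MetricSpace Y] (y z : Fin Q → Y) (σ : Equiv.Perm (Fin Q)) :
    gDist (ofFn y) (ofFn z) ≤ √(∑ i, dist (y i) (z (σ i)) ^ 2) := by
  rw [gDist_ofFn]
  exact ciInf_le (Set.finite_range _).bddBelow σ

theorem exists_gDist_ofFn_eq [MetricSpace Y] (y z : Fin Q → Y) :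
    ∃ σ : Equiv.Perm (Fin Q), gDist (ofFn y) (ofFn z) = √(∑ i, dist (y i) (z (σ i)) ^ 2) := by
  rw [gDist_ofFn]
  obtain ⟨σ, hσ⟩ := exists_eq_ciInf_of_finite
    (f := fun σ : Equiv.Perm (Fin Q) => √(∑ i, dist (y i) (z (σ i)) ^ 2))
  exact ⟨σ, hσ.symm⟩

theorem gDist_triangle [MetricSpace Y] (u v w : Sym Y Q) :
    gDist u w ≤ gDist u v + gDist v w := by
  obtain ⟨x, rfl⟩ := exists_ofFn_eq u
  obtain ⟨y, rfl⟩ := exists_ofFn_eq v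
  obtain ⟨z, rfl⟩ := exists_ofFn_eq w
  obtain ⟨σ, hσ⟩ := exists_gDist_ofFn_eq x y
  obtain ⟨τ, hτ⟩ := exists_gDist_ofFn_eq y z
  have h1 : √(∑ i, dist (y i) (z (τ i)) ^ 2) =
      √(∑ i, dist (y (σ i)) (z (τ (σ i))) ^ 2) := by
    rw [Equiv.sum_comp σ fun i => dist (y i) (z (τ i)) ^ 2]
  rw [hσ, hτ, h1]
  refine (gDist_ofFn_le x z (τ * σ)).trans ?_
  have h2 : √(∑ i, dist (x i) (z ((τ * σ) i)) ^ 2) ≤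
      √(∑ i, (dist (x i) (y (σ i)) + dist (y (σ i)) (z (τ (σ i)))) ^ 2) := by
    refine Real.sqrt_le_sqrt (Finset.sum_le_sum fun i _ => ?_)
    exact pow_le_pow_left₀ dist_nonneg (dist_triangle _ _ _) 2
  refine h2.trans ?_
  have h3 := norm_add_le
    (WithLp.toLp 2 fun i => dist (x i) (y (σ i)) : EuclideanSpace ℝ (Fin Q))
    (WithLp.toLp 2 fun i => dist (y (σ i)) (z (τ (σ i))))
  simpa [EuclideanSpace.norm_eq, sq_abs] using h3

/-- The metric space `(𝒬_Q(Y), 𝒢)`. -/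
noncomputable instance [MetricSpace Y] : MetricSpace (Sym Y Q) where
  dist := gDist
  dist_self v := by
    obtain ⟨y, rfl⟩ := exists_ofFn_eq v
    refine le_antisymm ((gDist_ofFn_le y y 1).trans (by simp)) ?_
    exact Real.iInf_nonneg fun _ => Real.sqrt_nonneg _
  dist_comm v w := by
    obtain ⟨y, rfl⟩ := exists_ofFn_eq v
    obtain ⟨z, rfl⟩ := exists_ofFn_eq w
    rw [gDist_ofFn, gDist_ofFn]
    refine Equiv.iInf_congr (Equiv.inv _) fun σ => ?_
    congr 1
    refine (Equiv.sum_comp σ fun i => _).symm.trans ?_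
    simp [dist_comm]
  dist_triangle := gDist_triangle
  eq_of_dist_eq_zero := by
    intro v w h
    obtain ⟨y, rfl⟩ := exists_ofFn_eq v
    obtain ⟨z, rfl⟩ := exists_ofFn_eq w
    obtain ⟨σ, hσ⟩ := exists_gDist_ofFn_eq y z
    rw [show gDist (ofFn y) (ofFn z) = 0 from h, eq_comm, Real.sqrt_eq_zero (by positivity),
      Finset.sum_eq_zero_iff_of_nonneg (fun _ _ => by positivity)] at hσ
    refine ofFn_eq_ofFn_iff.2 ⟨σ, funext fun i => ?_⟩
    simpa using hσ i (Finset.mem_univ i)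

/-- `𝒬_Q(Y)` carries its Borel `σ`-algebra. -/
noncomputable instance [MetricSpace Y] : MeasurableSpace (Sym Y Q) := borel _

instance [MetricSpace Y] : BorelSpace (Sym Y Q) := ⟨rfl⟩

end Tuples

/-! ### The Radon–Nikodým property -/

/-- A Banach space `Y` has the Radon–Nikodým property if, for every finite measure space, every
`Y`-valued countably additive vector measure which has bounded variation and is absolutely
continuous with respect to the given measure has a Bochner integrable density. -/
def RadonNikodymProperty (Y : Type*) [NormedAddCommGroup Y] [NormedSpace ℝ Y] : Prop :=
  ∀ (Ω : Type) [MeasurableSpace Ω] (ν : Measure Ω) [IsFiniteMeasure ν] (m : VectorMeasure Ω Y),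
    m.variation Set.univ < ∞ →
    (∀ E, MeasurableSet E → ν E = 0 → m E = 0) →
    ∃ g : Ω → Y, Integrable g ν ∧ ∀ E, MeasurableSet E → m E = ∫ ω in E, g ω ∂ν

/-! ### Approximate differentiability -/

section Differentiability

variable {X : Type*} [NormedAddCommGroup X] [NormedSpace ℝ X] [MeasurableSpace X]
  {Y : Type*} [NormedAddCommGroup Y] [NormedSpace ℝ Y] {Q : ℕ}

/-- The set `S` has density zero at `a`. Since `μ` is a Haar measure below, `μ (closedBall a r)` is
a constant multiple of `r ^ dim X`. -/
def DensityZeroAt (μ : Measure X) (S : Set X) (a : X) : Prop :=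
  Tendsto (fun r : ℝ => μ (S ∩ Metric.closedBall a r) / μ (Metric.closedBall a r))
    (𝓝[>] 0) (𝓝 0)

/-- `f` and `g` are approximately tangent at `a`. -/
def ApproxTangentAt (μ : Measure X) (f g : X → Sym Y Q) (a : X) : Prop :=
  ∀ ε : ℝ, 0 < ε → DensityZeroAt μ {x | ε * ‖x - a‖ < dist (f x) (g x)} a

/-- The affine `Q`-valued map `x ↦ ⟦A₁ x, …, A_Q x⟧` given by `A = ⟦A₁, …, A_Q⟧`. -/
def evalAffine (A : Sym (X →ᵃ[ℝ] Y) Q) (x : X) : Sym Y Q := A.map fun A' => A' x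

/-- `f` is approximately differentiable at `a`: some affine `Q`-valued map is approximately tangent
to `f` at `a`. -/
def ApproxDifferentiableAt (μ : Measure X) (f : X → Sym Y Q) (a : X) : Prop :=
  ∃ A : Sym (X →ᵃ[ℝ] Y) Q, ApproxTangentAt μ f (evalAffine A) a

open Classical in
/-- `Af(a)`, the (unique) affine `Q`-valued map approximately tangent to `f` at `a`, as an unordered tuple of
affine maps (`Q⟦0⟧` where `f` is not approximately differentiable). -/
noncomputable def approxAffine (μ : Measure X) (f : X → Sym Y Q) (a : X) : Sym (X →ᵃ[ℝ] Y) Q :=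
  if h : ApproxDifferentiableAt μ f a then h.choose else Sym.replicate Q 0

/-- `f` is unambiguously approximately differentiable at `a`: moreover, branches of `Af(a)` with the
same value at `a` have the same linear part. -/
def UnambiguouslyApproxDifferentiableAt (μ : Measure X) (f : X → Sym Y Q) (a : X) : Prop :=
  ApproxDifferentiableAt μ f a ∧
    ∀ A ∈ approxAffine μ f a, ∀ A' ∈ approxAffine μ f a, A a = A' a → A.linear = A'.linear

/-- `Df(a) = ⟦L₁, …, L_Q⟧`, the unordered tuple of the linear parts of `Af(a) = ⟦A₁, …, A_Q⟧`
(`Q⟦0⟧` where `f` is not approximately differentiable). -/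
noncomputable def approxDeriv [FiniteDimensional ℝ X] (μ : Measure X) (f : X → Sym Y Q) (a : X) :
    Sym (X →L[ℝ] Y) Q :=
  (approxAffine μ f a).map fun A => LinearMap.toContinuousLinearMap A.linear

/-- `𝒢(v, Q⟦0⟧) = √(∑ᵢ ‖Lᵢ‖²)` for `v = ⟦L₁, …, L_Q⟧`, with the operator norm. -/
noncomputable def tupleNorm (v : Sym (X →L[ℝ] Y) Q) : ℝ := dist v (Sym.replicate Q 0)

end Differentiability

end QValued

/-!
A Lipschitz map `f : X → 𝒬_Q(Y)` is analysed through three facts.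

*Tangency.* A set of density zero at `a` misses every ball of radius `ε t` centred in
`closedBall a t`, for small `t`. Hence an affine `Q`-valued map which is approximately tangent to the
Lipschitz map `f` is tangent to it in the usual sense (`ApproxTangentAt.tangentAt`). Such a map is
unique (`TangentAt.unique`): along each ray a permutation identifies the branches of two of them, and
a real vector space is not a finite union of proper subspaces. For small `t`, an optimal matching of
the values of the tangent map at `a + t v` and at `a` respects the values at `a`, so that
`∑ᵢ ‖Lᵢ v‖² ≤ (K ‖v‖)²` (`TangentAt.sum_norm_sq_le`). Together these give part (C).

*Existence.* The set where `f` has exactly `k` distinct values is Borel. Near one of its points, `f`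
coincides on this set with `⟦g₁, …, g_Q⟧` for globally defined Lipschitz maps `gᵢ : X → Y`, any two of
which are equal or have different values there (`exists_local_selection`); the map `gᵢ` is the average
of a cut off function over the values of `f`, so no Lipschitz extension theorem is needed.
Rademacher's theorem extends to the target `Y`
(`RadonNikodymProperty.ae_differentiableAt`): a Lipschitz curve is the primitive of the density of
its increment measure, and linearity of the line derivatives is tested on countably many functionals.
At a density point of the stratum where all the `gᵢ` are differentiable, their first order expansions
form an unambiguous approximate tangent map. This is part (A).

*The graph of the derivative.* The values of `f` span a closed separable subspace `S`, which also
contains those of the tangent maps. The set of pairs `(a, T)`, with `T` an unordered tuple of pairs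
(value, linear part) tangent to `f` at `a`, is Borel in the Polish space `X × 𝒬_Q(S × Hom(X, S))` and
projects injectively to `X`. The Lusin–Souslin theorem gives part (B).

For part (D), an injective unit speed curve `γ` carries the Lebesgue measure of `[0, 1]` to `ℋ¹` on its
trace (`map_restrict_eq_hausdorffMeasure`). The real function `t ↦ 𝒢(f(γ t), f(γ 0))` is absolutely
continuous with derivative at most `|Df(γ t)|` almost everywhere, and the fundamental theorem of
calculus applies.
-/

open MeasureTheory Filter Topology
open scoped NNReal ENNReal

namespace QValued

/-! ### Unordered tuples and their metric -/

section Tuples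

variable {Y Z : Type*} {Q : ℕ}

theorem coe_ofFn (y : Fin Q → Y) : (ofFn y : Multiset Y) = Finset.univ.val.map y := rfl

theorem map_ofFn (Φ : Y → Z) (y : Fin Q → Y) : (ofFn y).map Φ = ofFn (Φ ∘ y) := by
  apply Sym.ext
  rw [Sym.coe_map, coe_ofFn, coe_ofFn, Multiset.map_map]

theorem mem_ofFn {y : Fin Q → Y} {z : Y} : z ∈ ofFn y ↔ ∃ i, y i = z := by
  rw [← Sym.mem_coe]
  change z ∈ Multiset.map y Finset.univ.val ↔ _
  simp

theorem ofFn_comp_perm (y : Fin Q → Y) (σ : Equiv.Perm (Fin Q)) : ofFn (y ∘ σ) = ofFn y :=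
  ofFn_eq_ofFn_iff.2 ⟨σ, rfl⟩

theorem ofFn_const (y : Y) : ofFn (fun _ : Fin Q => y) = Sym.replicate Q y := by
  apply Sym.ext
  rw [coe_ofFn, Sym.coe_replicate]
  simp

variable [MetricSpace Y] [MetricSpace Z]

theorem dist_ofFn_le (y z : Fin Q → Y) (σ : Equiv.Perm (Fin Q)) :
    dist (ofFn y) (ofFn z) ≤ √(∑ i, dist (y i) (z (σ i)) ^ 2) :=
  gDist_ofFn_le y z σ

theorem exists_dist_ofFn_eq (y z : Fin Q → Y) :
    ∃ σ : Equiv.Perm (Fin Q), dist (ofFn y) (ofFn z) = √(∑ i, dist (y i) (z (σ i)) ^ 2) :=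
  exists_gDist_ofFn_eq y z

theorem exists_perm_forall_dist_le (y z : Fin Q → Y) :
    ∃ σ : Equiv.Perm (Fin Q), ∀ i, dist (y i) (z (σ i)) ≤ dist (ofFn y) (ofFn z) := by
  obtain ⟨σ, hσ⟩ := exists_dist_ofFn_eq y z
  refine ⟨σ, fun i => hσ ▸ Real.le_sqrt_of_sq_le ?_⟩
  exact Finset.single_le_sum (f := fun i => dist (y i) (z (σ i)) ^ 2)
    (fun _ _ => sq_nonneg _) (Finset.mem_univ i)

/-- A numbering of one tuple can be transported to a numbering of any other tuple at the cost of
their distance. -/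
theorem exists_numbering_forall_dist_le (y : Fin Q → Y) (w : Sym Y Q) :
    ∃ z : Fin Q → Y, ofFn z = w ∧ ∀ i, dist (y i) (z i) ≤ dist (ofFn y) w := by
  obtain ⟨z, rfl⟩ := exists_ofFn_eq w
  obtain ⟨σ, hσ⟩ := exists_perm_forall_dist_le y z
  exact ⟨z ∘ σ, ofFn_comp_perm z σ, hσ⟩

theorem dist_ofFn_le_of_forall_le {y z : Fin Q → Y} {c : ℝ} (hc : 0 ≤ c)
    (h : ∀ i, dist (y i) (z i) ≤ c) : dist (ofFn y) (ofFn z) ≤ √Q * c := by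
  refine (dist_ofFn_le y z 1).trans ?_
  rw [← Real.sqrt_sq hc, ← Real.sqrt_mul (Nat.cast_nonneg Q)]
  refine Real.sqrt_le_sqrt ((Finset.sum_le_card_nsmul _ _ (c ^ 2) fun i _ => ?_).trans ?_)
  · exact pow_le_pow_left₀ dist_nonneg (h i) 2
  · simp

theorem lipschitzWith_map {K : ℝ≥0} {Φ : Y → Z} (hΦ : LipschitzWith K Φ) :
    LipschitzWith K (Sym.map Φ : Sym Y Q → Sym Z Q) := by
  refine LipschitzWith.of_dist_le_mul fun v w => ?_
  obtain ⟨y, rfl⟩ := exists_ofFn_eq v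
  obtain ⟨z, rfl⟩ := exists_ofFn_eq w
  obtain ⟨σ, hσ⟩ := exists_dist_ofFn_eq y z
  rw [map_ofFn, map_ofFn, hσ, ← Real.sqrt_sq K.coe_nonneg, ← Real.sqrt_mul (sq_nonneg _), Finset.mul_sum]
  refine (dist_ofFn_le _ _ σ).trans (Real.sqrt_le_sqrt (Finset.sum_le_sum fun i _ => ?_))
  rw [← mul_pow]
  exact pow_le_pow_left₀ dist_nonneg (hΦ.dist_le_mul _ _) 2

theorem lipschitzWith_ofFn : LipschitzWith (NNReal.sqrt Q) (ofFn : (Fin Q → Y) → Sym Y Q) := by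
  refine LipschitzWith.of_dist_le_mul fun y z => ?_
  simpa using dist_ofFn_le_of_forall_le dist_nonneg fun i => dist_le_pi_dist y z i

instance [SecondCountableTopology Y] : SecondCountableTopology (Sym Y Q) := by
  have : TopologicalSpace.SeparableSpace (Sym Y Q) :=
    (Function.Surjective.denseRange exists_ofFn_eq).separableSpace
      (lipschitzWith_ofFn (Y := Y) (Q := Q)).continuous
  exact UniformSpace.secondCountable_of_separable _

/-- A fast Cauchy sequence of tuples lifts to a Cauchy sequence of numberings. -/
instance [CompleteSpace Y] : CompleteSpace (Sym Y Q) := by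
  refine Metric.complete_of_convergent_controlled_sequences (fun n => (1 / 2 : ℝ) ^ n)
    (fun n => by positivity) fun u hu => ?_
  choose s hs hs' using fun (y : Fin Q → Y) (w : Sym Y Q) => exists_numbering_forall_dist_le y w
  let y : ℕ → Fin Q → Y := fun n => Nat.rec (numbering (u 0)) (fun n z => s z (u (n + 1))) n
  have hy : ∀ n, ofFn (y n) = u n := by
    rintro (_ | n)
    · exact ofFn_numbering _
    · exact hs _ _
  have hd : ∀ n, dist (y n) (y (n + 1)) ≤ 1 * (1 / 2 : ℝ) ^ n := fun n => by
    rw [one_mul, dist_pi_le_iff (by positivity)]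
    refine fun i => (hs' (y n) (u (n + 1)) i).trans ?_
    rw [hy]
    exact (hu n n (n + 1) le_rfl n.le_succ).le
  obtain ⟨z, hz⟩ := cauchySeq_tendsto_of_complete
    (cauchySeq_of_le_geometric (1 / 2) 1 (by norm_num) hd)
  refine ⟨ofFn z, ?_⟩
  have := ((lipschitzWith_ofFn (Y := Y) (Q := Q)).continuous.tendsto z).comp hz
  simpa only [Function.comp_def, hy] using this

theorem lipschitzWith_sum {E : Type*} [SeminormedAddCommGroup E] {K : ℝ≥0} {Φ : Y → E}
    (hΦ : LipschitzWith K Φ) :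
    LipschitzWith (Q * K) fun v : Sym Y Q => ((v : Multiset Y).map Φ).sum := by
  refine LipschitzWith.of_dist_le_mul fun v w => ?_
  obtain ⟨y, rfl⟩ := exists_ofFn_eq v
  obtain ⟨z, rfl, hz⟩ := exists_numbering_forall_dist_le y w
  simp only [coe_ofFn, Multiset.map_map, Function.comp_apply]
  change dist (∑ i, Φ (y i)) (∑ i, Φ (z i)) ≤ _
  refine (dist_sum_sum_le _ _ _).trans ((Finset.sum_le_card_nsmul _ _ _ fun i _ =>
    (hΦ.dist_le_mul _ _).trans (mul_le_mul_of_nonneg_left (hz i) K.2)).trans ?_)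
  simp [mul_assoc]

end Tuples

/-! ### Tangency of a Lipschitz map and an affine `Q`-valued map -/

section Tangency

variable {X : Type*} [NormedAddCommGroup X] [NormedSpace ℝ X]
  {Y : Type*} [NormedAddCommGroup Y] [NormedSpace ℝ Y] {Q : ℕ}

theorem evalAffine_ofFn (A : Fin Q → X →ᵃ[ℝ] Y) (x : X) :
    evalAffine (ofFn A) x = ofFn fun i => A i x :=
  map_ofFn _ _

theorem affine_apply_add (A : X →ᵃ[ℝ] Y) (a v : X) : A (a + v) = A a + A.linear v := by
  have := A.map_vadd a v
  simpa [add_comm] using this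

/-- The map `f` and the affine `Q`-valued map given by `A` agree to first order at `a`, in the
usual (not approximate) sense. -/
def TangentAt (f : X → Sym Y Q) (A : Sym (X →ᵃ[ℝ] Y) Q) (a : X) : Prop :=
  ∀ ε : ℝ, 0 < ε → ∀ᶠ x in 𝓝 a, dist (f x) (evalAffine A x) ≤ ε * ‖x - a‖

theorem TangentAt.evalAffine_self {f : X → Sym Y Q} {A : Sym (X →ᵃ[ℝ] Y) Q} {a : X}
    (h : TangentAt f A a) : evalAffine A a = f a := by
  have := (h 1 one_pos).self_of_nhds
  rw [sub_self, norm_zero, mul_zero] at this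
  exact (dist_le_zero.1 this).symm

theorem TangentAt.eventually_ray {f : X → Sym Y Q} {A : Sym (X →ᵃ[ℝ] Y) Q} {a : X}
    (h : TangentAt f A a) (v : X) {ε : ℝ} (hε : 0 < ε) :
    ∀ᶠ t : ℝ in 𝓝[>] 0, dist (f (a + t • v)) (evalAffine A (a + t • v)) ≤ ε * t := by
  have hc : Tendsto (fun t : ℝ => a + t • v) (𝓝[>] 0) (𝓝 a) := by
    have : Continuous fun t : ℝ => a + t • v := by fun_prop
    simpa using (this.tendsto 0).mono_left nhdsWithin_le_nhds
  filter_upwards [hc.eventually (h (ε / (‖v‖ + 1)) (by positivity)), self_mem_nhdsWithin]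
    with t ht ht0
  refine ht.trans ?_
  have h0 : (0 : ℝ) < t := ht0
  rw [add_sub_cancel_left, norm_smul, Real.norm_of_nonneg h0.le, div_mul_eq_mul_div,
    div_le_iff₀ (by positivity)]
  nlinarith [mul_pos hε h0]

theorem eventually_lt_norm_add_smul {p : Y} (hp : p ≠ 0) (q : Y) (c : ℝ) :
    ∀ᶠ t : ℝ in 𝓝[>] 0, c * t < ‖p + t • q‖ := by
  have hc : Continuous fun t : ℝ => ‖p + t • q‖ - c * t := by fun_prop
  have h0 : 0 < ‖p + (0 : ℝ) • q‖ - c * 0 := by simpa using hp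
  filter_upwards [((hc.tendsto 0).mono_left nhdsWithin_le_nhds).eventually (lt_mem_nhds h0)]
    with t ht
  linarith

theorem exists_eventually_lt_norm_add_smul {p q : Y} (h : p = 0 → q ≠ 0) :
    ∃ ε : ℝ, 0 < ε ∧ ∀ᶠ t : ℝ in 𝓝[>] 0, ε * t < ‖p + t • q‖ := by
  by_cases hp : p = 0
  · have hq : 0 < ‖q‖ := norm_pos_iff.2 (h hp)
    refine ⟨‖q‖ / 2, half_pos hq, ?_⟩
    filter_upwards [self_mem_nhdsWithin] with t ht
    have h0 : (0 : ℝ) < t := ht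
    rw [hp, zero_add, norm_smul, Real.norm_of_nonneg h0.le]
    nlinarith [mul_pos hq h0]
  · exact ⟨1, one_pos, eventually_lt_norm_add_smul hp q 1⟩

/-- Two affine `Q`-valued maps which agree to first order along a ray can be numbered so that they
agree along this ray. -/
theorem exists_perm_eq_along_ray (A B : Fin Q → X →ᵃ[ℝ] Y) (a v : X)
    (h : ∀ ε : ℝ, 0 < ε → ∀ᶠ t : ℝ in 𝓝[>] 0,
      dist (evalAffine (ofFn A) (a + t • v)) (evalAffine (ofFn B) (a + t • v)) ≤ ε * t) :
    ∃ σ : Equiv.Perm (Fin Q), ∀ i, A i a = B (σ i) a ∧ (A i).linear v = (B (σ i)).linear v := by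
  by_contra! hne
  choose i hi using hne
  have hex : ∀ σ : Equiv.Perm (Fin Q), ∃ ε : ℝ, 0 < ε ∧ ∀ᶠ t : ℝ in 𝓝[>] 0, ε * t <
      ‖(A (i σ) a - B (σ (i σ)) a) + t • ((A (i σ)).linear v - (B (σ (i σ))).linear v)‖ :=
    fun σ => exists_eventually_lt_norm_add_smul fun h0 =>
      sub_ne_zero.2 (hi σ (sub_eq_zero.1 h0))
  choose ε hε hev using hex
  obtain ⟨σ₀, hσ₀⟩ := Finite.exists_min ε
  obtain ⟨t, h1, h2, h3⟩ :=
    ((h (ε σ₀) (hε σ₀)).and ((eventually_all.2 hev).and self_mem_nhdsWithin)).exists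
  have h3' : (0 : ℝ) < t := h3
  rw [evalAffine_ofFn, evalAffine_ofFn] at h1
  obtain ⟨σ, hσ⟩ := exists_perm_forall_dist_le (fun i => A i (a + t • v))
    fun i => B i (a + t • v)
  have h4 := ((hσ (i σ)).trans h1).trans (mul_le_mul_of_nonneg_right (hσ₀ σ) h3'.le)
  refine (h2 σ).not_ge (le_trans (le_of_eq ?_) h4)
  rw [dist_eq_norm, affine_apply_add, affine_apply_add, map_smul, map_smul, smul_sub]
  congr 1
  abel

/-- The tangent affine `Q`-valued map is unique. Along each ray a permutation identifies the
branches; since a real vector space is not a finite union of proper subspaces, one permutation does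
so along all rays. -/
theorem TangentAt.unique {f : X → Sym Y Q} {A B : Sym (X →ᵃ[ℝ] Y) Q} {a : X}
    (hA : TangentAt f A a) (hB : TangentAt f B a) : A = B := by
  obtain ⟨A, rfl⟩ := exists_ofFn_eq A
  obtain ⟨B, rfl⟩ := exists_ofFn_eq B
  have hray : ∀ v, ∃ σ : Equiv.Perm (Fin Q), ∀ i,
      A i a = B (σ i) a ∧ (A i).linear v = (B (σ i)).linear v := fun v => by
    refine exists_perm_eq_along_ray A B a v fun ε hε => ?_
    filter_upwards [hA.eventually_ray v (half_pos hε), hB.eventually_ray v (half_pos hε)]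
      with t h1 h2
    linarith [dist_triangle_left (evalAffine (ofFn A) (a + t • v))
      (evalAffine (ofFn B) (a + t • v)) (f (a + t • v))]
  let W : {σ : Equiv.Perm (Fin Q) // ∀ i, A i a = B (σ i) a} → Submodule ℝ X := fun σ =>
    ⨅ i, LinearMap.eqLocus (A i).linear (B (σ.1 i)).linear
  have hW : ⋃ σ, (W σ : Set X) = Set.univ := by
    refine Set.eq_univ_of_forall fun v => ?_
    obtain ⟨σ, hσ⟩ := hray v
    refine Set.mem_iUnion.2 ⟨⟨σ, fun i => (hσ i).1⟩, ?_⟩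
    simpa [W] using fun i => (hσ i).2
  obtain ⟨⟨σ, hσ⟩, hσ'⟩ := Subspace.exists_eq_top_of_iUnion_eq_univ hW
  refine ofFn_eq_ofFn_iff.2 ⟨σ, funext fun i => AffineMap.ext fun x => ?_⟩
  have hx : x - a ∈ W ⟨σ, hσ⟩ := hσ' ▸ Submodule.mem_top
  have hx' : ∀ i, (A i).linear (x - a) = (B (σ i)).linear (x - a) := by
    simpa only [W, Submodule.mem_iInf, LinearMap.mem_eqLocus] using hx
  have := affine_apply_add (A i) a (x - a)
  rw [hx', hσ, ← affine_apply_add, add_sub_cancel] at this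
  exact this

/-- The derivative of a `K`-Lipschitz map satisfies `∑ᵢ ‖Lᵢ v‖² ≤ (K ‖v‖)²`: for small `t` an
optimal matching of the values at `a + t v` with those at `a` only matches equal values of the
branches at `a`. -/
theorem TangentAt.sum_norm_sq_le {f : X → Sym Y Q} {K : ℝ≥0} (hf : LipschitzWith K f)
    {A : Fin Q → X →ᵃ[ℝ] Y} {a : X} (hA : TangentAt f (ofFn A) a) (v : X) :
    ∑ i, ‖(A i).linear v‖ ^ 2 ≤ (K * ‖v‖) ^ 2 := by
  have key : ∀ ε : ℝ, 0 < ε → ∑ i, ‖(A i).linear v‖ ^ 2 ≤ (K * ‖v‖ + ε) ^ 2 := fun ε hε => by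
    have hsep : ∀ σ : Equiv.Perm (Fin Q), ∀ i, ∀ᶠ t : ℝ in 𝓝[>] 0, A i a ≠ A (σ i) a →
        (K * ‖v‖ + ε) * t < ‖(A i a - A (σ i) a) + t • (A i).linear v‖ := fun σ i => by
      by_cases hi : A i a = A (σ i) a
      · exact Eventually.of_forall fun t h => absurd hi h
      · filter_upwards [eventually_lt_norm_add_smul (sub_ne_zero.2 hi) ((A i).linear v)
          (K * ‖v‖ + ε)] with t ht _ using ht
    obtain ⟨t, h1, h2, h3⟩ := ((hA.eventually_ray v hε).and
      ((eventually_all.2 fun σ => eventually_all.2 (hsep σ)).and self_mem_nhdsWithin)).exists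
    have h3' : (0 : ℝ) < t := h3
    have h4 : dist (evalAffine (ofFn A) (a + t • v)) (evalAffine (ofFn A) a) ≤
        (K * ‖v‖ + ε) * t := by
      have h5 := hf.dist_le_mul (a + t • v) a
      rw [dist_eq_norm, add_sub_cancel_left, norm_smul, Real.norm_of_nonneg h3'.le] at h5
      rw [hA.evalAffine_self]
      have := dist_triangle_left (evalAffine (ofFn A) (a + t • v)) (f a) (f (a + t • v))
      linarith
    rw [evalAffine_ofFn, evalAffine_ofFn] at h4
    obtain ⟨σ, hσ⟩ := exists_dist_ofFn_eq (fun i => A i (a + t • v)) fun i => A i a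
    have hd : ∀ i, dist (A i (a + t • v)) (A (σ i) a) =
        ‖(A i a - A (σ i) a) + t • (A i).linear v‖ := fun i => by
      rw [dist_eq_norm, affine_apply_add, map_smul]
      congr 1
      abel
    rw [hσ] at h4
    have heq : ∀ i, A i a = A (σ i) a := fun i => by
      by_contra hi
      refine (h2 σ i hi).not_ge (le_trans ?_ h4)
      rw [← hd]
      exact Real.le_sqrt_of_sq_le (Finset.single_le_sum
        (f := fun i => dist (A i (a + t • v)) (A (σ i) a) ^ 2)
        (fun _ _ => sq_nonneg _) (Finset.mem_univ i))
    have hd' : ∀ i, dist (A i (a + t • v)) (A (σ i) a) ^ 2 = t ^ 2 * ‖(A i).linear v‖ ^ 2 :=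
      fun i => by
        rw [hd, sub_eq_zero.2 (heq i), zero_add, norm_smul, mul_pow, Real.norm_eq_abs, sq_abs]
    simp only [hd', ← Finset.mul_sum] at h4
    rw [Real.sqrt_le_left (by positivity), mul_pow, mul_comm] at h4
    exact le_of_mul_le_mul_right h4 (by positivity)
  have hlim : Tendsto (fun ε : ℝ => (K * ‖v‖ + ε) ^ 2) (𝓝[>] 0) (𝓝 ((K * ‖v‖) ^ 2)) := by
    have : Continuous fun ε : ℝ => (K * ‖v‖ + ε) ^ 2 := by fun_prop
    simpa using (this.tendsto 0).mono_left nhdsWithin_le_nhds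
  exact ge_of_tendsto hlim (by filter_upwards [self_mem_nhdsWithin] with ε hε using key ε hε)

theorem tupleNorm_nonneg (v : Sym (X →L[ℝ] Y) Q) : 0 ≤ tupleNorm v := dist_nonneg

theorem tupleNorm_ofFn (L : Fin Q → X →L[ℝ] Y) : tupleNorm (ofFn L) = √(∑ i, ‖L i‖ ^ 2) := by
  obtain ⟨σ, hσ⟩ := exists_dist_ofFn_eq L fun _ => 0
  rw [ofFn_const] at hσ
  rw [tupleNorm, hσ]
  simp

variable [FiniteDimensional ℝ X]

theorem exists_lipschitzWith_evalAffine (A : Sym (X →ᵃ[ℝ] Y) Q) :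
    ∃ M, LipschitzWith M (evalAffine A) := by
  obtain ⟨A, rfl⟩ := exists_ofFn_eq A
  refine ⟨NNReal.sqrt Q * ∑ i, ‖LinearMap.toContinuousLinearMap (A i).linear‖₊,
    LipschitzWith.of_dist_le_mul fun x y => ?_⟩
  rw [evalAffine_ofFn, evalAffine_ofFn, NNReal.coe_mul, mul_assoc]
  simp only [Real.coe_sqrt, NNReal.coe_natCast]
  refine dist_ofFn_le_of_forall_le (by positivity) fun i => ?_
  have h1 : dist (A i x) (A i y) = ‖LinearMap.toContinuousLinearMap (A i).linear (x - y)‖ := by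
    have := affine_apply_add (A i) y (x - y)
    rw [add_sub_cancel] at this
    rw [this, dist_eq_norm, add_sub_cancel_left]
    rfl
  rw [h1, dist_eq_norm]
  refine (ContinuousLinearMap.le_opNorm _ _).trans
    (mul_le_mul_of_nonneg_right ?_ (norm_nonneg _))
  have := Finset.single_le_sum (f := fun i => ‖LinearMap.toContinuousLinearMap (A i).linear‖₊)
    (fun _ _ => zero_le) (Finset.mem_univ i)
  exact_mod_cast this

theorem TangentAt.tupleNorm_le {f : X → Sym Y Q} {K : ℝ≥0} (hf : LipschitzWith K f)
    {A : Sym (X →ᵃ[ℝ] Y) Q} {a : X} (hA : TangentAt f A a) :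
    tupleNorm (A.map fun A => LinearMap.toContinuousLinearMap A.linear) ≤ √(Q : ℝ) * K := by
  obtain ⟨A, rfl⟩ := exists_ofFn_eq A
  rw [map_ofFn, tupleNorm_ofFn, ← Real.sqrt_sq K.coe_nonneg, ← Real.sqrt_mul (Nat.cast_nonneg Q)]
  refine Real.sqrt_le_sqrt ((Finset.sum_le_card_nsmul _ _ ((K : ℝ) ^ 2) fun i _ => ?_).trans ?_)
  · refine pow_le_pow_left₀ (norm_nonneg _) (ContinuousLinearMap.opNorm_le_bound _ K.2 fun v => ?_) 2
    refine (sq_le_sq₀ (norm_nonneg _) (mul_nonneg K.2 (norm_nonneg v))).1 ?_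
    exact (Finset.single_le_sum (f := fun i => ‖(A i).linear v‖ ^ 2)
      (fun _ _ => sq_nonneg _) (Finset.mem_univ i)).trans (hA.sum_norm_sq_le hf v)
  · simp

theorem dist_evalAffine_le (A : Sym (X →ᵃ[ℝ] Y) Q) (a v : X) :
    dist (evalAffine A (a + v)) (evalAffine A a) ≤
      tupleNorm (A.map fun A => LinearMap.toContinuousLinearMap A.linear) * ‖v‖ := by
  obtain ⟨A, rfl⟩ := exists_ofFn_eq A
  rw [map_ofFn, tupleNorm_ofFn, evalAffine_ofFn, evalAffine_ofFn, ← Real.sqrt_sq (norm_nonneg v),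
    ← Real.sqrt_mul (by positivity), Finset.sum_mul]
  refine (dist_ofFn_le _ _ 1).trans (Real.sqrt_le_sqrt (Finset.sum_le_sum fun i _ => ?_))
  rw [← mul_pow]
  refine pow_le_pow_left₀ dist_nonneg ?_ 2
  rw [affine_apply_add, dist_eq_norm, Equiv.Perm.one_apply, add_sub_cancel_left]
  exact (LinearMap.toContinuousLinearMap (A i).linear).le_opNorm v

end Tangency

/-! ### Approximate tangency -/

section Approximate

variable {X : Type*} [NormedAddCommGroup X] [NormedSpace ℝ X] [MeasurableSpace X]
  {μ : Measure X} {Y : Type*} [NormedAddCommGroup Y] [NormedSpace ℝ Y] {Q : ℕ}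

theorem approxTangentAt_of_eventually {f : X → Sym Y Q} {A : Sym (X →ᵃ[ℝ] Y) Q} {a : X}
    {F : Set X} (hF : DensityZeroAt μ Fᶜ a)
    (h : ∀ ε : ℝ, 0 < ε → ∀ᶠ x in 𝓝 a, x ∈ F → dist (f x) (evalAffine A x) ≤ ε * ‖x - a‖) :
    ApproxTangentAt μ f (evalAffine A) a := by
  intro ε hε
  obtain ⟨r, hr, hr'⟩ := Metric.mem_nhds_iff.1 (h ε hε)
  refine tendsto_of_tendsto_of_tendsto_of_le_of_le' tendsto_const_nhds hF
    (Eventually.of_forall fun _ => zero_le) ?_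
  filter_upwards [Ioo_mem_nhdsGT hr] with t ht
  have hsub : {x | ε * ‖x - a‖ < dist (f x) (evalAffine A x)} ∩ Metric.closedBall a t ⊆
      Fᶜ ∩ Metric.closedBall a t := by
    refine fun x hx => ⟨fun hxF => ?_, hx.2⟩
    exact (hr' (Metric.mem_ball.2 ((Metric.mem_closedBall.1 hx.2).trans_lt ht.2)) hxF).not_gt hx.1
  exact ENNReal.div_le_div_right (measure_mono hsub) _

theorem TangentAt.approxTangentAt {f : X → Sym Y Q} {A : Sym (X →ᵃ[ℝ] Y) Q} {a : X}
    (h : TangentAt f A a) : ApproxTangentAt μ f (evalAffine A) a := by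
  refine approxTangentAt_of_eventually (F := Set.univ) ?_ fun ε hε => ?_
  · simp [DensityZeroAt]
  · filter_upwards [h ε hε] with x hx _ using hx

variable [FiniteDimensional ℝ X] [BorelSpace X] [μ.IsAddHaarMeasure]

/-- A set of density zero at `a` contains no ball of radius `ε t` centred in `closedBall a t`, for
small `t`: such a ball occupies the fixed fraction `(ε / 2) ^ dim X` of `closedBall a (2 t)`. -/
theorem DensityZeroAt.eventually_exists_notMem {S : Set X} {a : X} (h : DensityZeroAt μ S a)
    {ε : ℝ} (hε : 0 < ε) :
    ∀ᶠ t : ℝ in 𝓝[>] 0, ∀ x, dist x a ≤ t → ∃ y ∉ S, dist y x ≤ ε * t := by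
  wlog hε1 : ε ≤ 1 generalizing ε
  · filter_upwards [this one_pos le_rfl, self_mem_nhdsWithin] with t ht ht0 x hx
    obtain ⟨y, hy, hyx⟩ := ht x hx
    have h0 : (0 : ℝ) < t := ht0
    exact ⟨y, hy, hyx.trans (by nlinarith)⟩
  have h2 : Tendsto (fun t : ℝ => 2 * t) (𝓝[>] 0) (𝓝[>] 0) := by
    refine tendsto_nhdsWithin_iff.2 ⟨?_, ?_⟩
    · have : Continuous fun t : ℝ => 2 * t := by fun_prop
      simpa using (this.tendsto 0).mono_left nhdsWithin_le_nhds
    · filter_upwards [self_mem_nhdsWithin] with t ht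
      have h0 : (0 : ℝ) < t := ht
      exact mul_pos two_pos h0
  set n := Module.finrank ℝ X
  have hc : (0 : ℝ≥0∞) < ENNReal.ofReal ((ε / 2) ^ n) := ENNReal.ofReal_pos.2 (by positivity)
  filter_upwards [(h.comp h2).eventually (gt_mem_nhds hc), self_mem_nhdsWithin] with t ht ht0 x hx
  have h0 : (0 : ℝ) < t := ht0
  by_contra! hall
  refine ht.not_ge ?_
  have hsub : Metric.closedBall x (ε * t) ⊆ S ∩ Metric.closedBall a (2 * t) := fun y hy => by
    refine ⟨by_contra fun hyS => (hall y hyS).not_ge hy, ?_⟩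
    have h1 : dist y x ≤ ε * t := hy
    have := dist_triangle y x a
    refine Metric.mem_closedBall.2 ?_
    nlinarith
  have hB : μ (Metric.closedBall a (2 * t)) ≠ 0 :=
    (Metric.measure_closedBall_pos μ a (by positivity)).ne'
  have hB' : μ (Metric.closedBall a (2 * t)) ≠ ∞ := measure_closedBall_lt_top.ne
  rw [Function.comp_apply, ENNReal.le_div_iff_mul_le (Or.inl hB) (Or.inl hB')]
  refine le_trans (le_of_eq ?_) (measure_mono hsub)
  rw [Measure.addHaar_closedBall μ _ (by positivity), Measure.addHaar_closedBall μ _ (by positivity),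
    ← mul_assoc, ← ENNReal.ofReal_mul (by positivity), ← mul_pow]
  congr 3
  ring

/-- For a Lipschitz map, approximate tangency is tangency. -/
theorem ApproxTangentAt.tangentAt {f : X → Sym Y Q} {K : ℝ≥0} (hf : LipschitzWith K f)
    {A : Sym (X →ᵃ[ℝ] Y) Q} {a : X} (h : ApproxTangentAt μ f (evalAffine A) a) :
    TangentAt f A a := by
  obtain ⟨M, hM⟩ := exists_lipschitzWith_evalAffine A
  intro ε hε
  obtain ⟨δ, hδ, hδ1, hδε⟩ : ∃ δ : ℝ, 0 < δ ∧ δ ≤ 1 ∧ (2 + K + M) * δ ≤ ε := by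
    refine ⟨min 1 (ε / (2 + K + M)), by positivity, min_le_left _ _, ?_⟩
    rw [mul_comm, ← le_div_iff₀ (by positivity)]
    exact min_le_right _ _
  have hev := (h δ hδ).eventually_exists_notMem hδ
  have hmain : ∀ᶠ t : ℝ in 𝓝[>] 0, ∀ x, dist x a ≤ t →
      dist (f x) (evalAffine A x) ≤ ε * t := by
    filter_upwards [hev, self_mem_nhdsWithin] with t ht ht0 x hx
    have h0 : (0 : ℝ) < t := ht0
    obtain ⟨y, hy, hyx⟩ := ht x hx
    have hy' : dist (f y) (evalAffine A y) ≤ δ * ‖y - a‖ := not_lt.1 hy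
    have h1 : ‖y - a‖ ≤ 2 * t := by
      rw [← dist_eq_norm]
      have := dist_triangle y x a
      nlinarith
    have h2 := hf.dist_le_mul x y
    have h3 := hM.dist_le_mul y x
    have h4 := dist_triangle4 (f x) (f y) (evalAffine A y) (evalAffine A x)
    rw [dist_comm x y] at h2
    have h5 : (K : ℝ) * dist y x ≤ K * (δ * t) := mul_le_mul_of_nonneg_left hyx K.2
    have h6 : (M : ℝ) * dist y x ≤ M * (δ * t) := mul_le_mul_of_nonneg_left hyx M.2
    have h7 : δ * ‖y - a‖ ≤ δ * (2 * t) := mul_le_mul_of_nonneg_left h1 hδ.le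
    have h8 : (2 + K + M) * δ * t ≤ ε * t := mul_le_mul_of_nonneg_right hδε h0.le
    nlinarith
  -- The estimate at `a` itself follows by letting the radius tend to zero.
  have ha : dist (f a) (evalAffine A a) ≤ 0 := by
    have hlim : Tendsto (fun t : ℝ => ε * t) (𝓝[>] 0) (𝓝 0) := by
      have : Continuous fun t : ℝ => ε * t := by fun_prop
      simpa using (this.tendsto 0).mono_left nhdsWithin_le_nhds
    refine ge_of_tendsto hlim ?_
    filter_upwards [hmain, self_mem_nhdsWithin] with t ht ht0
    have h0 : (0 : ℝ) < t := ht0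
    exact ht a (by simpa using h0.le)
  obtain ⟨r, hr, hr'⟩ := mem_nhdsGT_iff_exists_Ioo_subset.1 hmain
  filter_upwards [Metric.ball_mem_nhds a hr] with x hx
  rcases eq_or_ne x a with rfl | hne
  · simpa using ha
  · rw [← dist_eq_norm]
    exact hr' ⟨dist_pos.2 hne, hx⟩ x le_rfl

theorem approxDifferentiableAt_iff {f : X → Sym Y Q} {K : ℝ≥0} (hf : LipschitzWith K f) {a : X}
    : ApproxDifferentiableAt μ f a ↔ ∃ A, TangentAt f A a :=
  ⟨fun ⟨A, hA⟩ => ⟨A, hA.tangentAt hf⟩, fun ⟨A, hA⟩ => ⟨A, hA.approxTangentAt⟩⟩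

theorem tangentAt_approxAffine {f : X → Sym Y Q} {K : ℝ≥0} (hf : LipschitzWith K f) {a : X}
    (h : ApproxDifferentiableAt μ f a) :
    TangentAt f (approxAffine μ f a) a := by
  rw [approxAffine, dif_pos h]
  exact ApproxTangentAt.tangentAt hf h.choose_spec

theorem TangentAt.approxAffine_eq {f : X → Sym Y Q} {K : ℝ≥0} (hf : LipschitzWith K f) {a : X}
    {A : Sym (X →ᵃ[ℝ] Y) Q} (h : TangentAt f A a) :
    approxAffine μ f a = A :=
  (tangentAt_approxAffine hf ((approxDifferentiableAt_iff hf).2 ⟨A, h⟩)).unique h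

end Approximate

/-! ### Rademacher's theorem for targets with the Radon–Nikodým property -/

section Rademacher

/-- The increment function of a Lipschitz curve extends from intervals to a vector measure dominated
by a multiple of the Lebesgue measure. -/
theorem exists_vectorMeasure_of_lipschitzWith {Y : Type*} [NormedAddCommGroup Y] [CompleteSpace Y]
    {g : ℝ → Y} {C : ℝ≥0}
    (hg : LipschitzWith C g) {a b : ℝ} (hab : a ≤ b) :
    ∃ m : VectorMeasure ℝ Y, (∀ t ∈ Set.Icc a b, m (Set.Ioc a t) = g t - g a) ∧
      ∀ s, ‖m s‖ₑ ≤ (C • volume.restrict (Set.Ioc a b)) s := by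
  let p : ℝ → ℝ := fun t => max a (min b t)
  have hp : ∀ u v, u ≤ v → edist (p v) (p u) ≤ volume (Set.Ioc u v ∩ Set.Ioc a b) := by
    intro u v huv
    rw [Set.Ioc_inter_Ioc, Real.volume_Ioc, edist_dist]
    rcases le_or_gt b u with hu | hu
    · simp [p, min_eq_left hu, min_eq_left (hu.trans huv)]
    rcases le_or_gt v a with hv | hv
    · have h1 : p v = a := max_eq_left ((min_le_right _ _).trans hv)
      have h2 : p u = a := max_eq_left ((min_le_right _ _).trans (huv.trans hv))
      simp [h1, h2]
    refine ENNReal.ofReal_le_ofReal ?_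
    rw [Real.dist_eq, abs_of_nonneg]
    · simp only [p, min_def, max_def]
      split_ifs <;> linarith
    · exact sub_nonneg.2 (max_le_max le_rfl (min_le_min le_rfl huv))
  have hA : ∀ s ∈ {s | ∃ u v : ℝ, u ≤ v ∧ s = Set.Ioc u v},
      ‖AddContent.onIoc (g ∘ p) s‖ₑ ≤ (C • volume.restrict (Set.Ioc a b)) s := by
    rintro s ⟨u, v, huv, rfl⟩
    rw [AddContent.onIoc_apply huv, ← edist_eq_enorm_sub]
    refine (hg.edist_le_mul _ _).trans ?_
    rw [Measure.smul_apply, Measure.restrict_apply measurableSet_Ioc]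
    exact mul_le_mul_right (hp u v huv) _
  have hB : (inferInstance : MeasurableSpace ℝ) =
      MeasurableSpace.generateFrom {s | ∃ u v : ℝ, u ≤ v ∧ s = Set.Ioc u v} := by
    rw [BorelSpace.measurable_eq (α := ℝ), borel_eq_generateFrom_Ioc_le ℝ]
    congr 1
    grind only
  obtain ⟨m, hm, hm'⟩ :=
    VectorMeasure.exists_extension_of_isSetSemiring_of_le_measure_of_generateFrom
      IsSetSemiring.Ioc hA hB
  refine ⟨m, fun t ht => ?_, hm'⟩
  rw [hm _ ⟨a, t, ht.1, rfl⟩, AddContent.onIoc_apply ht.1]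
  simp [p, ht.1, ht.2, ht.1.trans ht.2]

variable {Y : Type*} [NormedAddCommGroup Y] [NormedSpace ℝ Y]

/-- In a space with the Radon–Nikodým property, Lipschitz curves are almost everywhere
differentiable: they are primitives of the density of their increment measure. -/
theorem RadonNikodymProperty.ae_differentiableAt_real [CompleteSpace Y]
    (hY : RadonNikodymProperty Y) {g : ℝ → Y} {C : ℝ≥0} (hg : LipschitzWith C g) :
    ∀ᵐ t, DifferentiableAt ℝ g t := by
  have hloc : ∀ n : ℕ, ∀ᵐ t, t ∈ Set.Ioo (-n : ℝ) n → DifferentiableAt ℝ g t := by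
    intro n
    have hn : (-n : ℝ) ≤ n := by simp
    obtain ⟨m, hm, hm'⟩ := exists_vectorMeasure_of_lipschitzWith hg hn
    obtain ⟨h, hint, hh⟩ := hY ℝ (volume.restrict (Set.Ioc (-n : ℝ) n)) m
      ((VectorMeasure.variation_le_of_forall_enorm_le (fun E _ => hm' E) Set.univ).trans_lt
        (measure_lt_top _ _))
      (fun E _ hE => by
        have := hm' E
        rwa [Measure.smul_apply, hE, smul_zero, nonpos_iff_eq_zero, enorm_eq_zero] at this)
    have hI : IntervalIntegrable h volume (-n : ℝ) n :=
      (intervalIntegrable_iff_integrableOn_Ioc_of_le hn).2 hint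
    filter_upwards [hI.ae_hasDerivAt_integral] with t ht htn
    have h1 := ht (Set.uIcc_of_le hn ▸ Set.Ioo_subset_Icc_self htn) (-n) Set.left_mem_uIcc
    refine ((h1.const_add (g (-n))).congr_of_eventuallyEq ?_).differentiableAt
    filter_upwards [isOpen_Ioo.mem_nhds htn] with x hx
    have h2 := hm x (Set.Ioo_subset_Icc_self hx)
    rw [hh _ measurableSet_Ioc, Measure.restrict_restrict measurableSet_Ioc,
      Set.Ioc_inter_Ioc, max_self, min_eq_left hx.2.le] at h2
    rw [intervalIntegral.integral_of_le hx.1.le, h2]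
    abel
  filter_upwards [ae_all_iff.2 hloc] with t ht
  obtain ⟨n, hn⟩ := exists_nat_gt |t|
  exact ht n (abs_lt.1 hn)

/-- Countably many functionals separate the points of a separable set from zero. -/
theorem exists_countable_separating {S : Set Y} (hS : TopologicalSpace.IsSeparable S) :
    ∃ T : Set (StrongDual ℝ Y), T.Countable ∧ ∀ w ∈ S, (∀ φ ∈ T, φ w = 0) → w = 0 := by
  obtain ⟨c, hc, hSc⟩ := hS
  choose φ hφ hφ' using fun y : Y => exists_dual_vector'' ℝ y
  refine ⟨φ '' c, hc.image φ, fun w hw h0 => ?_⟩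
  by_contra hne
  obtain ⟨d, hd, hdw⟩ := Metric.mem_closure_iff.1 (hSc hw) (‖w‖ / 2) (by positivity)
  have h1 : ‖d‖ ≤ ‖d - w‖ := by
    have h2 : φ d (d - w) = ‖d‖ := by
      rw [map_sub, h0 _ ⟨d, hd, rfl⟩, sub_zero, hφ']
      rfl
    calc ‖d‖ = ‖φ d (d - w)‖ := by rw [h2, norm_norm]
      _ ≤ ‖φ d‖ * ‖d - w‖ := (φ d).le_opNorm _
      _ ≤ 1 * ‖d - w‖ := mul_le_mul_of_nonneg_right (hφ d) (norm_nonneg _)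
      _ = ‖d - w‖ := one_mul _
  rw [dist_comm, dist_eq_norm] at hdw
  have h3 := norm_sub_norm_le w (w - d)
  rw [sub_sub_cancel, norm_sub_rev w d] at h3
  linarith

variable {X : Type*} [NormedAddCommGroup X] [NormedSpace ℝ X] [FiniteDimensional ℝ X]
  [MeasurableSpace X] [BorelSpace X] {μ : Measure X} [μ.IsAddHaarMeasure]

theorem RadonNikodymProperty.ae_lineDifferentiableAt [CompleteSpace Y]
    (hY : RadonNikodymProperty Y) {f : X → Y} {C : ℝ≥0} (hf : LipschitzWith C f) (v : X) :
    ∀ᵐ p ∂μ, LineDifferentiableAt ℝ f p v := by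
  let L : ℝ →L[ℝ] X := ContinuousLinearMap.smulRight (1 : ℝ →L[ℝ] ℝ) v
  suffices A : ∀ p, ∀ᵐ t : ℝ ∂volume, LineDifferentiableAt ℝ f (p + t • v) v from
    ae_mem_of_ae_add_linearMap_mem L.toLinearMap volume μ
      (measurableSet_lineDifferentiableAt hf.continuous) A
  intro p
  filter_upwards [hY.ae_differentiableAt_real
    (hf.comp ((LipschitzWith.const p).add L.lipschitz))] with s hs
  have h1 : DifferentiableAt ℝ (fun t : ℝ => s + t) 0 := by fun_prop
  have hs' : DifferentiableAt ℝ (fun t : ℝ => f (p + t • v)) (s + 0) := by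
    rw [add_zero]
    exact hs
  simpa only [LineDifferentiableAt, add_smul, add_assoc, Function.comp_def] using hs'.comp 0 h1

/-- **Rademacher's theorem** for targets with the Radon–Nikodým property. The line derivatives exist
almost everywhere in a dense set of directions; they depend linearly on the direction because this
can be tested on countably many functionals, for which Rademacher's theorem is known. -/
theorem RadonNikodymProperty.ae_differentiableAt [CompleteSpace Y]
    (hY : RadonNikodymProperty Y) {f : X → Y} {C : ℝ≥0} (hf : LipschitzWith C f) :
    ∀ᵐ x ∂μ, DifferentiableAt ℝ f x := by
  obtain ⟨s, s_count, s_dense⟩ := TopologicalSpace.exists_countable_dense X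
  have hs : Metric.sphere (0 : X) 1 ⊆ closure s := by
    rw [s_dense.closure_eq]
    exact Set.subset_univ _
  let S : Submodule ℝ Y := (Submodule.span ℝ (Set.range f)).topologicalClosure
  have hS : TopologicalSpace.IsSeparable (S : Set Y) :=
    (TopologicalSpace.isSeparable_range hf.continuous).span.closure
  obtain ⟨T, T_count, hT⟩ := exists_countable_separating hS
  let B := Module.finBasis ℝ X
  have h1 : ∀ᵐ x ∂μ, ∀ v ∈ s, LineDifferentiableAt ℝ f x v :=
    (ae_ball_iff s_count).2 fun v _ => hY.ae_lineDifferentiableAt hf v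
  have h2 : ∀ᵐ x ∂μ, ∀ i, LineDifferentiableAt ℝ f x (B i) :=
    ae_all_iff.2 fun i => hY.ae_lineDifferentiableAt hf (B i)
  have h3 : ∀ᵐ x ∂μ, ∀ φ ∈ T, DifferentiableAt ℝ (fun y => φ (f y)) x :=
    (ae_ball_iff T_count).2 fun φ _ => (φ.lipschitz.comp hf).ae_differentiableAt
  filter_upwards [h1, h2, h3] with x h1 h2 h3
  have hmem : ∀ v, lineDeriv ℝ f x v ∈ S := fun v => by
    have h4 := range_deriv_subset_closure_span_image (𝕜 := ℝ) (fun t : ℝ => f (x + t • v))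
      dense_univ (Set.mem_range_self 0)
    refine closure_mono (Submodule.span_mono ?_) h4
    rintro _ ⟨t, -, rfl⟩
    exact ⟨_, rfl⟩
  have hφ : ∀ φ ∈ T, ∀ v, LineDifferentiableAt ℝ f x v →
      φ (lineDeriv ℝ f x v) = fderiv ℝ (fun y => φ (f y)) x v := fun φ hφ v hv => by
    have h5 : HasDerivAt (fun t : ℝ => φ (f (x + t • v))) (φ (lineDeriv ℝ f x v)) 0 :=
      φ.hasFDerivAt.comp_hasDerivAt (0 : ℝ) hv.hasLineDerivAt
    exact h5.unique ((h3 φ hφ).hasFDerivAt.hasLineDerivAt v)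
  let L : X →L[ℝ] Y :=
    LinearMap.toContinuousLinearMap (B.constr ℝ fun i => lineDeriv ℝ f x (B i))
  have hL : ∀ v, L v = ∑ i, B.repr v i • lineDeriv ℝ f x (B i) := fun v => by
    simp [L, Module.Basis.constr_apply_fintype]
  refine (hf.hasFDerivAt_of_hasLineDerivAt_of_closure hs (L := L) fun v hv => ?_).differentiableAt
  have hLv : L v = lineDeriv ℝ f x v := by
    refine sub_eq_zero.1 (hT _ ?_ fun φ hφT => ?_)
    · refine S.sub_mem ?_ (hmem v)
      rw [hL]
      exact S.sum_mem fun i _ => S.smul_mem _ (hmem _)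
    · rw [map_sub, hφ φ hφT v (h1 v hv), hL, map_sum, sub_eq_zero]
      conv_rhs => rw [← B.sum_repr v, map_sum]
      refine Finset.sum_congr rfl fun i _ => ?_
      rw [map_smul, map_smul, hφ φ hφT _ (h2 i)]
  rw [hLv]
  exact (h1 v hv).hasLineDerivAt

end Rademacher

/-! ### Strata of constant multiplicity -/

section Strata

variable {Y : Type*} {Q : ℕ}

/-- The number of distinct elements of an unordered tuple. -/
noncomputable def numDistinct (v : Sym Y Q) : ℕ := {z | z ∈ v}.ncard

theorem numDistinct_ofFn (y : Fin Q → Y) : numDistinct (ofFn y) = (Set.range y).ncard := by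
  rw [numDistinct]
  congr 1
  ext z
  simp [mem_ofFn]

theorem ncard_range_le_of_factors {y z : Fin Q → Y} (h : ∀ i j, z i = z j → y i = y j) :
    (Set.range y).ncard ≤ (Set.range z).ncard := by
  have hr : Function.extend z y id '' Set.range z = Set.range y := by
    rw [← Set.range_comp]
    exact congrArg Set.range (funext fun i => Function.FactorsThrough.extend_apply
      (fun i j => h i j) id i)
  rw [← hr]
  exact Set.ncard_image_le (Set.finite_range z)

theorem eq_of_ncard_range_le {y z : Fin Q → Y} (h : ∀ i j, z i = z j → y i = y j)
    (hle : (Set.range z).ncard ≤ (Set.range y).ncard) {i j : Fin Q} (hij : y i = y j) :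
    z i = z j := by
  have he : ∀ i, Function.extend z y id (z i) = y i :=
    fun i => Function.FactorsThrough.extend_apply (fun i j => h i j) id i
  have hr : Function.extend z y id '' Set.range z = Set.range y := by
    rw [← Set.range_comp]
    exact congrArg Set.range (funext he)
  have hinj : Set.InjOn (Function.extend z y id) (Set.range z) :=
    Set.injOn_of_ncard_image_eq
      (le_antisymm (Set.ncard_image_le (Set.finite_range z)) (hr ▸ hle)) (Set.finite_range z)
  exact hinj ⟨i, rfl⟩ ⟨j, rfl⟩ (by rw [he, he, hij])

variable [MetricSpace Y]

theorem exists_pos_separation (y : Fin Q → Y) :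
    ∃ ρ : ℝ, 0 < ρ ∧ ∀ i j, y i ≠ y j → 3 * ρ ≤ dist (y i) (y j) := by
  have hev : ∀ i j, ∀ᶠ ρ : ℝ in 𝓝[>] 0, y i ≠ y j → 3 * ρ ≤ dist (y i) (y j) := fun i j => by
    by_cases hij : y i = y j
    · exact Eventually.of_forall fun _ h => absurd hij h
    · filter_upwards [Ioo_mem_nhdsGT (show 0 < dist (y i) (y j) / 3 by
        have := dist_pos.2 hij; positivity)] with ρ hρ _
      linarith [hρ.2]
  obtain ⟨ρ, h, hρ⟩ := ((eventually_all.2 fun i => eventually_all.2 (hev i)).and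
    self_mem_nhdsWithin).exists
  exact ⟨ρ, hρ, h⟩

/-- A tuple close to `ofFn y` has a numbering close to `y`, which separates the indices that `y`
separates. -/
theorem exists_numbering_near {y : Fin Q → Y} {ρ : ℝ} (hρ : 0 < ρ)
    (hsep : ∀ i j, y i ≠ y j → 3 * ρ ≤ dist (y i) (y j)) {w : Sym Y Q}
    (hw : dist (ofFn y) w ≤ ρ) :
    ∃ z : Fin Q → Y, ofFn z = w ∧ (∀ i, dist (y i) (z i) ≤ ρ) ∧
      ∀ i j, z i = z j → y i = y j := by
  obtain ⟨z, hz, hd⟩ := exists_numbering_forall_dist_le y w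
  refine ⟨z, hz, fun i => (hd i).trans hw, fun i j hij => ?_⟩
  by_contra hne
  have h1 := dist_triangle_right (y i) (y j) (z i)
  have h2 := (hd i).trans hw
  have h3 := (hd j).trans hw
  rw [← hij] at h3
  linarith [hsep i j hne]

theorem isOpen_le_numDistinct (k : ℕ) : IsOpen {v : Sym Y Q | k ≤ numDistinct v} := by
  refine Metric.isOpen_iff.2 fun v hv => ?_
  obtain ⟨y, rfl⟩ := exists_ofFn_eq v
  obtain ⟨ρ, hρ, hsep⟩ := exists_pos_separation y
  refine ⟨ρ, hρ, fun w hw => ?_⟩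
  obtain ⟨z, rfl, -, hz⟩ := exists_numbering_near hρ hsep (Metric.mem_ball'.1 hw).le
  have hv' : k ≤ numDistinct (ofFn y) := hv
  refine hv'.trans ?_
  rw [numDistinct_ofFn, numDistinct_ofFn]
  exact ncard_range_le_of_factors hz

theorem measurableSet_numDistinct_eq {X : Type*} [TopologicalSpace X] [MeasurableSpace X]
    [OpensMeasurableSpace X] {f : X → Sym Y Q} (hf : Continuous f) (k : ℕ) :
    MeasurableSet {x | numDistinct (f x) = k} := by
  have h : {x | numDistinct (f x) = k} =
      f ⁻¹' {v | k ≤ numDistinct v} \ f ⁻¹' {v | k + 1 ≤ numDistinct v} := by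
    ext x
    simp only [Set.mem_ofPred_eq, Set.mem_sdiff, Set.mem_preimage]
    omega
  rw [h]
  exact ((isOpen_le_numDistinct k).preimage hf).measurableSet.diff
    ((isOpen_le_numDistinct (k + 1)).preimage hf).measurableSet

end Strata

section Selection

variable {Y : Type*} [NormedAddCommGroup Y] [NormedSpace ℝ Y] {Q : ℕ}

/-- The identity on `closedBall 0 ρ`, cut off to vanish outside `ball 0 (2 ρ)`. -/
noncomputable def cutoff (ρ : ℝ) (w : Y) : Y := max 0 (min 1 (2 - ‖w‖ / ρ)) • w

theorem cutoff_of_norm_le {ρ : ℝ} (hρ : 0 < ρ) {w : Y} (hw : ‖w‖ ≤ ρ) : cutoff ρ w = w := by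
  have : ‖w‖ / ρ ≤ 1 := (div_le_one hρ).2 hw
  rw [cutoff, min_eq_left (by linarith), max_eq_right zero_le_one, one_smul]

theorem cutoff_of_le_norm {ρ : ℝ} (hρ : 0 < ρ) {w : Y} (hw : 2 * ρ ≤ ‖w‖) : cutoff ρ w = 0 := by
  have : 2 ≤ ‖w‖ / ρ := (le_div_iff₀ hρ).2 hw
  rw [cutoff, max_eq_left ((min_le_right _ _).trans (by linarith)), zero_smul]

theorem lipschitzWith_cutoff {ρ : ℝ} (hρ : 0 < ρ) :
    LipschitzWith 3 (cutoff ρ : Y → Y) := by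
  refine LipschitzWith.of_dist_le_mul fun v w => ?_
  wlog hvw : ‖v‖ ≤ ‖w‖ generalizing v w
  · rw [dist_comm, dist_comm v]
    exact this w v (le_of_not_ge hvw)
  rcases le_or_gt (2 * ρ) ‖v‖ with hv | hv
  · rw [cutoff_of_le_norm hρ hv, cutoff_of_le_norm hρ (hv.trans hvw), dist_self]
    positivity
  set c : Y → ℝ := fun w => max 0 (min 1 (2 - ‖w‖ / ρ)) with hc
  have h0 : 0 ≤ c w := le_max_left _ _
  have h1 : c w ≤ 1 := max_le zero_le_one (min_le_left _ _)
  have h2 : |c v - c w| ≤ ‖v - w‖ / ρ := by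
    have h3 : |c v - c w| ≤ |(2 - ‖v‖ / ρ) - (2 - ‖w‖ / ρ)| := by
      refine (abs_max_sub_max_le_max _ _ _ _).trans ?_
      rw [sub_self, abs_zero]
      refine max_le (abs_nonneg _) ((abs_min_sub_min_le_max _ _ _ _).trans ?_)
      rw [sub_self, abs_zero]
      exact max_le (abs_nonneg _) le_rfl
    refine h3.trans ?_
    rw [sub_sub_sub_cancel_left, ← sub_div, abs_div, abs_of_pos hρ, norm_sub_rev]
    exact div_le_div_of_nonneg_right (abs_norm_sub_norm_le w v) hρ.le
  have h4 : cutoff ρ v - cutoff ρ w = c w • (v - w) + (c v - c w) • v := by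
    simp only [cutoff, hc, smul_sub, sub_smul]
    abel
  rw [dist_eq_norm, dist_eq_norm, h4]
  calc ‖c w • (v - w) + (c v - c w) • v‖ ≤ c w * ‖v - w‖ + |c v - c w| * ‖v‖ := by
        refine (norm_add_le _ _).trans ?_
        rw [norm_smul, norm_smul, Real.norm_of_nonneg h0, Real.norm_eq_abs]
    _ ≤ 1 * ‖v - w‖ + ‖v - w‖ / ρ * (2 * ρ) := by gcongr
    _ = ((3 : ℝ≥0) : ℝ) * ‖v - w‖ := by
        push_cast
        field_simp
        ring

/-- Near any point, a Lipschitz `Q`-valued map is given, on the set where the number of distinct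
values is the one at that point, by `Q` globally defined Lipschitz maps which either coincide
everywhere or have different values. The branch through `y i` is obtained by averaging the cut off
displacements `z - y i` over all values `z`. -/
theorem exists_local_selection {X : Type*} [PseudoMetricSpace X] {f : X → Sym Y Q} {K : ℝ≥0}
    (hf : LipschitzWith K f) (a : X) :
    ∃ U ∈ 𝓝 a, ∃ g : Fin Q → X → Y, (∀ i, ∃ C, LipschitzWith C (g i)) ∧
      ∀ x ∈ U, numDistinct (f x) = numDistinct (f a) →
        f x = ofFn (fun i => g i x) ∧ ∀ i j, g i x = g j x → g i = g j := by
  classical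
  obtain ⟨y, hy⟩ := exists_ofFn_eq (f a)
  obtain ⟨ρ, hρ, hsep⟩ := exists_pos_separation y
  let m : Fin Q → ℕ := fun i => (Finset.univ.filter fun j => y j = y i).card
  have hm : ∀ i, (m i : ℝ) ≠ 0 := fun i =>
    Nat.cast_ne_zero.2 (Finset.card_ne_zero_of_mem
      (Finset.mem_filter.2 ⟨Finset.mem_univ i, rfl⟩))
  let g : Fin Q → X → Y := fun i x =>
    y i + (m i : ℝ)⁻¹ • ((f x : Multiset Y).map fun z => cutoff ρ (z - y i)).sum
  refine ⟨f ⁻¹' Metric.closedBall (f a) ρ,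
    hf.continuous.continuousAt (Metric.closedBall_mem_nhds _ hρ), g, fun i => ?_, ?_⟩
  · have h1 : LipschitzWith 1 fun z : Y => z - y i :=
      LipschitzWith.of_dist_le_mul fun z w => by simp
    exact ⟨_, (LipschitzWith.const (y i)).add (((lipschitzWith_smul _).comp
      ((lipschitzWith_sum ((lipschitzWith_cutoff hρ).comp h1)).comp hf)))⟩
  · intro x hx hk
    have hx' : dist (ofFn y) (f x) ≤ ρ := hy ▸ Metric.mem_closedBall'.1 hx
    obtain ⟨z, hz, hd, hzy⟩ := exists_numbering_near hρ hsep hx'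
    have hyz : ∀ i j, y i = y j → z i = z j := fun i j hij =>
      eq_of_ncard_range_le hzy (by
        rw [← numDistinct_ofFn, ← numDistinct_ofFn, hz, hy, hk]) hij
    have hcut : ∀ i j, cutoff ρ (z j - y i) = if y j = y i then z i - y i else 0 := fun i j => by
      split_ifs with hij
      · rw [hyz j i hij, cutoff_of_norm_le hρ]
        rw [← dist_eq_norm, dist_comm]
        exact hd i
      · refine cutoff_of_le_norm hρ ?_
        rw [← dist_eq_norm]
        linarith [hsep j i hij, hd j, dist_triangle (y j) (z j) (y i)]
    have hg : ∀ i, g i x = z i := fun i => by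
      have h1 : ((f x : Multiset Y).map fun z => cutoff ρ (z - y i)).sum =
          ∑ j, cutoff ρ (z j - y i) := by
        rw [← hz, coe_ofFn, Multiset.map_map]
        rfl
      simp only [g]
      rw [h1]
      simp only [hcut]
      rw [← Finset.sum_filter, Finset.sum_const, ← Nat.cast_smul_eq_nsmul ℝ,
        inv_smul_smul₀ (hm i), add_sub_cancel]
    refine ⟨?_, fun i j hij => ?_⟩
    · rw [← hz]
      exact congrArg ofFn (funext fun i => (hg i).symm)
    · have h1 : y i = y j := hzy i j (by rw [← hg, ← hg, hij])
      simp only [g, m, h1]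

end Selection

/-! ### Approximate differentiability almost everywhere -/

section AlmostEverywhere

variable {X : Type*} [NormedAddCommGroup X] [NormedSpace ℝ X]
  {Y : Type*} [NormedAddCommGroup Y] [NormedSpace ℝ Y] {Q : ℕ}

/-- The affine map with value `y` at `a` and linear part `L`. -/
def affineAt (a : X) (y : Y) (L : X →L[ℝ] Y) : X →ᵃ[ℝ] Y where
  toFun x := y + L (x - a)
  linear := L
  map_vadd' x v := by
    simp only [vadd_eq_add, map_sub, map_add, ContinuousLinearMap.coe_coe]
    abel

theorem affineAt_apply (a : X) (y : Y) (L : X →L[ℝ] Y) (x : X) :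
    affineAt a y L x = y + L (x - a) := rfl

variable [FiniteDimensional ℝ X] [MeasurableSpace X] [BorelSpace X] {μ : Measure X}
  [μ.IsAddHaarMeasure]

/-- At almost every point, some unambiguous affine `Q`-valued map is approximately tangent: this
happens at the density points of a stratum where the branches of a local selection are
differentiable. -/
theorem RadonNikodymProperty.ae_exists_approxTangentAt [CompleteSpace Y]
    (hY : RadonNikodymProperty Y) {f : X → Sym Y Q} {K : ℝ≥0} (hf : LipschitzWith K f) :
    ∀ᵐ a ∂μ, ∃ A : Fin Q → X →ᵃ[ℝ] Y, ApproxTangentAt μ f (evalAffine (ofFn A)) a ∧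
      ∀ i j, A i a = A j a → (A i).linear = (A j).linear := by
  have : ProperSpace X := FiniteDimensional.proper ℝ X
  set P : X → Prop := fun a => ∃ A : Fin Q → X →ᵃ[ℝ] Y,
    ApproxTangentAt μ f (evalAffine (ofFn A)) a ∧
      ∀ i j, A i a = A j a → (A i).linear = (A j).linear with hP
  suffices h : ∀ k, ∀ᵐ a ∂μ, numDistinct (f a) = k → P a by
    filter_upwards [ae_all_iff.2 h] with a ha using ha _ rfl
  intro k
  set F : Set X := {x | numDistinct (f x) = k} with hF
  have hFm : MeasurableSet F := measurableSet_numDistinct_eq hf.continuous k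
  refine measure_null_of_locally_null _ fun a₀ ha₀ => ?_
  have hk₀ : numDistinct (f a₀) = k := (Classical.not_imp.1 ha₀).1
  obtain ⟨U, hU, g, hgL, hg⟩ := exists_local_selection hf a₀
  obtain ⟨V, hVU, hVo, hV⟩ := mem_nhds_iff.1 hU
  choose C hC using hgL
  have hae : ∀ᵐ a ∂μ, a ∈ V → numDistinct (f a) = k → P a := by
    filter_upwards [Besicovitch.ae_tendsto_measure_inter_div_of_measurableSet μ hFm.compl,
      ae_all_iff.2 fun i => hY.ae_differentiableAt (μ := μ) (hC i)] with a hdens hdiff haV hak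
    have haF : a ∈ F := hak
    rw [Set.indicator_of_notMem (Set.notMem_compl_iff.2 haF)] at hdens
    refine ⟨fun i => affineAt a (g i a) (fderiv ℝ (g i) a), ?_, fun i j hij => ?_⟩
    · refine approxTangentAt_of_eventually (F := F) hdens fun ε hε => ?_
      have hε' : 0 < ε / (√Q + 1) := by positivity
      have hev : ∀ᶠ x in 𝓝 a, ∀ i, ‖g i x - g i a - fderiv ℝ (g i) a (x - a)‖ ≤
          ε / (√Q + 1) * ‖x - a‖ :=
        eventually_all.2 fun i => (hdiff i).hasFDerivAt.isLittleO.def hε'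
      filter_upwards [hev, hVo.mem_nhds haV] with x hx hxV hxF
      rw [(hg x (hVU hxV) (hxF.trans hk₀.symm)).1, evalAffine_ofFn]
      refine (dist_ofFn_le_of_forall_le (c := ε / (√Q + 1) * ‖x - a‖) (by positivity)
        fun i => ?_).trans ?_
      · rw [dist_eq_norm, affineAt_apply, ← sub_sub]
        exact hx i
      · rw [← mul_assoc]
        refine mul_le_mul_of_nonneg_right ?_ (norm_nonneg _)
        rw [mul_div_assoc', div_le_iff₀ (by positivity)]
        nlinarith
    · rw [affineAt_apply, affineAt_apply, sub_self, map_zero, map_zero, add_zero, add_zero] at hij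
      simp only [(hg a (hVU haV) (hak.trans hk₀.symm)).2 i j hij]
  refine ⟨_, inter_mem_nhdsWithin _ (hVo.mem_nhds hV), ?_⟩
  refine measure_mono_null (fun a ha => ?_) (ae_iff.1 hae)
  exact fun h => ha.1 (h ha.2)

theorem RadonNikodymProperty.ae_unambiguouslyApproxDifferentiableAt [CompleteSpace Y]
    (hY : RadonNikodymProperty Y) {f : X → Sym Y Q} {K : ℝ≥0} (hf : LipschitzWith K f) :
    ∀ᵐ a ∂μ, UnambiguouslyApproxDifferentiableAt μ f a := by
  filter_upwards [hY.ae_exists_approxTangentAt (μ := μ) hf] with a ⟨A, hA, hlin⟩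
  refine ⟨⟨_, hA⟩, ?_⟩
  rw [(hA.tangentAt hf).approxAffine_eq hf]
  intro B hB B' hB'
  obtain ⟨i, rfl⟩ := mem_ofFn.1 hB
  obtain ⟨j, rfl⟩ := mem_ofFn.1 hB'
  exact hlin i j

end AlmostEverywhere

/-! ### Borel measurability of the derivative -/

section Measurability

variable {X : Type*} [NormedAddCommGroup X] [NormedSpace ℝ X]
  {Y : Type*} [NormedAddCommGroup Y] [NormedSpace ℝ Y] {Q : ℕ}

/-- The values of a continuous `Q`-valued map on a separable space form a separable set. -/
theorem isSeparable_values {X Y : Type*} [TopologicalSpace X] [TopologicalSpace.SeparableSpace X]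
    [MetricSpace Y] {f : X → Sym Y Q} (hf : Continuous f) :
    TopologicalSpace.IsSeparable {z | ∃ x, z ∈ f x} := by
  obtain ⟨D, hD, hDd⟩ := TopologicalSpace.exists_countable_dense X
  refine ⟨⋃ x ∈ D, Set.range (numbering (f x)),
    hD.biUnion fun x _ => (Set.finite_range _).countable, ?_⟩
  rintro z ⟨x, hz⟩
  refine Metric.mem_closure_iff.2 fun ε hε => ?_
  obtain ⟨x', hx', hx'D⟩ := hDd.inter_open_nonempty _
    ((Metric.isOpen_ball (x := f x) (ε := ε)).preimage hf) ⟨x, Metric.mem_ball_self hε⟩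
  obtain ⟨y, hy⟩ := exists_ofFn_eq (f x)
  rw [← hy] at hz
  obtain ⟨i, rfl⟩ := mem_ofFn.1 hz
  obtain ⟨σ, hσ⟩ := exists_perm_forall_dist_le y (numbering (f x'))
  refine ⟨numbering (f x') (σ i), Set.mem_biUnion hx'D ⟨σ i, rfl⟩, (hσ i).trans_lt ?_⟩
  rw [hy, ofFn_numbering]
  exact Metric.mem_ball'.1 hx'

variable {Z : Type*} [NormedAddCommGroup Z] [NormedSpace ℝ Z]

/-- The tuple of `Y`-valued affine maps with values and linear parts at `a` given by a tuple of
pairs in a space `Z` embedded in `Y` by `ι`. -/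
def affineTuple (ι : Z →ₗᵢ[ℝ] Y) (a : X) (T : Sym (Z × (X →L[ℝ] Z)) Q) : Sym (X →ᵃ[ℝ] Y) Q :=
  T.map fun p => affineAt a (ι p.1) (ι.toContinuousLinearMap.comp p.2)

theorem affineTuple_injective (ι : Z →ₗᵢ[ℝ] Y) (a : X) :
    Function.Injective (affineTuple ι a : Sym (Z × (X →L[ℝ] Z)) Q → Sym (X →ᵃ[ℝ] Y) Q) := by
  refine Sym.map_injective (fun p q h => ?_) Q
  have h1 : ∀ x, ι p.1 + ι (p.2 (x - a)) = ι q.1 + ι (q.2 (x - a)) := fun x => DFunLike.congr_fun h x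
  have h2 : p.1 = q.1 := by simpa using h1 a
  refine Prod.ext h2 (ContinuousLinearMap.ext fun v => ?_)
  have h3 := h1 (a + v)
  rw [h2, add_sub_cancel_left] at h3
  exact ι.injective (add_left_cancel h3)

theorem evalAffine_affineTuple (ι : Z →ₗᵢ[ℝ] Y) (a : X) (T : Sym (Z × (X →L[ℝ] Z)) Q) (v : X) :
    evalAffine (affineTuple ι a T) (a + v) = T.map fun p => ι (p.1 + p.2 v) := by
  rw [evalAffine, affineTuple, Sym.map_map]
  congr 1
  funext p
  simp [affineAt_apply]

theorem continuous_map_eval (ι : Z →ₗᵢ[ℝ] Y) (v : X) :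
    Continuous fun T : Sym (Z × (X →L[ℝ] Z)) Q => T.map fun p => ι (p.1 + p.2 v) := by
  let Λ : Z × (X →L[ℝ] Z) →L[ℝ] Y :=
    ι.toContinuousLinearMap.comp (ContinuousLinearMap.fst ℝ Z (X →L[ℝ] Z) +
      (ContinuousLinearMap.apply ℝ Z v).comp (ContinuousLinearMap.snd ℝ Z (X →L[ℝ] Z)))
  have hL : LipschitzWith ‖Λ‖₊ Λ := Λ.lipschitz
  exact (lipschitzWith_map hL).continuous

theorem continuous_map_comp (ι : Z →ₗᵢ[ℝ] Y) :
    Continuous fun T : Sym (Z × (X →L[ℝ] Z)) Q =>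
      T.map fun p => ι.toContinuousLinearMap.comp p.2 := by
  let Λ : Z × (X →L[ℝ] Z) →L[ℝ] (X →L[ℝ] Y) :=
    (ContinuousLinearMap.compL ℝ X Z Y ι.toContinuousLinearMap).comp
      (ContinuousLinearMap.snd ℝ Z (X →L[ℝ] Z))
  have hL : LipschitzWith ‖Λ‖₊ Λ := Λ.lipschitz
  exact (lipschitzWith_map hL).continuous

/-- If the values of `f` lie in a closed subspace then so do those of the tangent affine map. -/
theorem TangentAt.exists_affineTuple [FiniteDimensional ℝ X] {S : Submodule ℝ Y}
    (hS : IsClosed (S : Set Y)) {f : X → Sym Y Q} (hfS : ∀ x, ∀ z ∈ f x, z ∈ S)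
    {A : Sym (X →ᵃ[ℝ] Y) Q} {a : X} (hA : TangentAt f A a) :
    ∃ T : Sym (S × (X →L[ℝ] S)) Q, affineTuple S.subtypeₗᵢ a T = A := by
  obtain ⟨A, rfl⟩ := exists_ofFn_eq A
  have h0 : ∀ i, A i a ∈ S := fun i => by
    refine hfS a _ ?_
    rw [← hA.evalAffine_self, evalAffine_ofFn]
    exact mem_ofFn.2 ⟨i, rfl⟩
  have h1 : ∀ i v, (A i).linear v ∈ S := fun i v => by
    rw [← SetLike.mem_coe, ← hS.closure_eq]
    refine Metric.mem_closure_iff.2 fun ε hε => ?_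
    obtain ⟨t, ht, ht0⟩ := ((hA.eventually_ray v (half_pos hε)).and self_mem_nhdsWithin).exists
    have ht0' : (0 : ℝ) < t := ht0
    obtain ⟨z, hz⟩ := exists_ofFn_eq (f (a + t • v))
    rw [evalAffine_ofFn, ← hz, dist_comm] at ht
    obtain ⟨σ, hσ⟩ := exists_perm_forall_dist_le (fun i => A i (a + t • v)) z
    have hzS : z (σ i) ∈ S := hfS (a + t • v) _ (hz ▸ mem_ofFn.2 ⟨_, rfl⟩)
    refine ⟨t⁻¹ • (z (σ i) - A i a), S.smul_mem _ (S.sub_mem hzS (h0 i)), ?_⟩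
    have h2 := (hσ i).trans ht
    have h3 : (A i).linear v - t⁻¹ • (z (σ i) - A i a) = t⁻¹ • (A i (a + t • v) - z (σ i)) := by
      rw [affine_apply_add, map_smul, smul_sub, smul_sub, smul_add, inv_smul_smul₀ ht0'.ne']
      abel
    rw [dist_eq_norm, h3, norm_smul, norm_inv, Real.norm_of_nonneg ht0'.le, ← dist_eq_norm,
      inv_mul_lt_iff₀ ht0']
    nlinarith
  refine ⟨ofFn fun i => (⟨A i a, h0 i⟩, LinearMap.toContinuousLinearMap
    ((A i).linear.codRestrict S (h1 i))), ?_⟩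
  rw [affineTuple, map_ofFn]
  congr 1
  funext i
  refine AffineMap.ext fun x => ?_
  have := affine_apply_add (A i) a (x - a)
  rw [add_sub_cancel] at this
  rw [this]
  rfl

theorem map_linear_affineTuple [FiniteDimensional ℝ X] (ι : Z →ₗᵢ[ℝ] Y) (a : X)
    (T : Sym (Z × (X →L[ℝ] Z)) Q) :
    (affineTuple ι a T).map (fun A => LinearMap.toContinuousLinearMap A.linear) =
      T.map fun p => ι.toContinuousLinearMap.comp p.2 := by
  rw [affineTuple, Sym.map_map]
  rfl

theorem tangentAt_affineTuple_iff {ι : Z →ₗᵢ[ℝ] Y} {f : X → Sym Y Q} {a : X}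
    {T : Sym (Z × (X →L[ℝ] Z)) Q} :
    TangentAt f (affineTuple ι a T) a ↔ ∀ n : ℕ, ∃ m : ℕ, ∀ v : X, ‖v‖ < 1 / (m + 1 : ℝ) →
      dist (f (a + v)) (T.map fun p => ι (p.1 + p.2 v)) ≤ 1 / (n + 1 : ℝ) * ‖v‖ := by
  constructor
  · intro h n
    obtain ⟨r, hr, hr'⟩ := Metric.mem_nhds_iff.1 (h (1 / (n + 1 : ℝ)) (by positivity))
    obtain ⟨m, hm⟩ := exists_nat_one_div_lt hr
    refine ⟨m, fun v hv => ?_⟩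
    have h1 : a + v ∈ Metric.ball a r := by
      rw [Metric.mem_ball, dist_eq_norm, add_sub_cancel_left]
      exact hv.trans hm
    have h2 : dist (f (a + v)) (evalAffine (affineTuple ι a T) (a + v)) ≤
        1 / (n + 1 : ℝ) * ‖a + v - a‖ := hr' h1
    rwa [evalAffine_affineTuple, add_sub_cancel_left] at h2
  · intro h ε hε
    obtain ⟨n, hn⟩ := exists_nat_one_div_lt hε
    obtain ⟨m, hm⟩ := h n
    filter_upwards [Metric.ball_mem_nhds a (show (0 : ℝ) < 1 / (m + 1 : ℝ) by positivity)]
      with x hx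
    rw [Metric.mem_ball, dist_eq_norm] at hx
    have h1 := hm (x - a) hx
    rw [← evalAffine_affineTuple, add_sub_cancel] at h1
    exact h1.trans (mul_le_mul_of_nonneg_right hn.le (norm_nonneg _))

variable [FiniteDimensional ℝ X] [MeasurableSpace X] [BorelSpace X]

theorem measurableSet_tangentAt_affineTuple (ι : Z →ₗᵢ[ℝ] Y)
    [SecondCountableTopology Z] {f : X → Sym Y Q} (hf : Continuous f) :
    MeasurableSet {p : X × Sym (Z × (X →L[ℝ] Z)) Q | TangentAt f (affineTuple ι p.1 p.2) p.1} := by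
  have : ProperSpace X := FiniteDimensional.proper ℝ X
  have heq : {p : X × Sym (Z × (X →L[ℝ] Z)) Q | TangentAt f (affineTuple ι p.1 p.2) p.1} =
      ⋂ n : ℕ, ⋃ m : ℕ, ⋂ v : X, ⋂ _ : ‖v‖ < 1 / (m + 1 : ℝ),
        {p | dist (f (p.1 + v)) (p.2.map fun q => ι (q.1 + q.2 v)) ≤
          1 / (n + 1 : ℝ) * ‖v‖} := by
    ext p
    simp only [Set.mem_iInter, Set.mem_iUnion]
    exact tangentAt_affineTuple_iff
  rw [heq]
  refine MeasurableSet.iInter fun n => MeasurableSet.iUnion fun m => IsClosed.measurableSet ?_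
  refine isClosed_iInter fun v => isClosed_iInter fun _ => isClosed_le ?_ continuous_const
  exact (hf.comp (continuous_fst.add continuous_const)).dist
    ((continuous_map_eval ι v).comp continuous_snd)

/-- The graph of `a ↦ Af(a)` is a Borel set in a Polish space. As it projects injectively to `X`, the
Lusin–Souslin theorem shows that its Borel subsets have Borel projections. -/
theorem measurable_approxDeriv (μ : Measure X) [μ.IsAddHaarMeasure] [CompleteSpace Y]
    {f : X → Sym Y Q} {K : ℝ≥0} (hf : LipschitzWith K f) :
    MeasurableSet {a | ApproxDifferentiableAt μ f a} ∧ Measurable (approxDeriv μ f) := by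
  have : ProperSpace X := FiniteDimensional.proper ℝ X
  let S : Submodule ℝ Y := (Submodule.span ℝ {z | ∃ x, z ∈ f x}).topologicalClosure
  have hS : IsClosed (S : Set Y) := Submodule.isClosed_topologicalClosure _
  have hfS : ∀ x, ∀ z ∈ f x, z ∈ S := fun x z hz =>
    Submodule.le_topologicalClosure _ (Submodule.subset_span ⟨x, hz⟩)
  have hsep : TopologicalSpace.IsSeparable (S : Set Y) :=
    (isSeparable_values hf.continuous).span.closure
  have : CompleteSpace S := hS.completeSpace_coe
  have : TopologicalSpace.SeparableSpace S := hsep.separableSpace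
  have : SecondCountableTopology S := UniformSpace.secondCountable_of_separable S
  let P : Set (X × Sym (S × (X →L[ℝ] S)) Q) := {p | TangentAt f (affineTuple S.subtypeₗᵢ p.1 p.2) p.1}
  have hP : MeasurableSet P := measurableSet_tangentAt_affineTuple S.subtypeₗᵢ hf.continuous
  have hinj : Set.InjOn Prod.fst P := by
    rintro ⟨a, T⟩ h ⟨b, T'⟩ h' (rfl : a = b)
    exact Prod.ext rfl (affineTuple_injective S.subtypeₗᵢ a (TangentAt.unique h h'))
  have himage : ∀ P' ⊆ P, MeasurableSet P' → MeasurableSet (Prod.fst '' P') := fun P' hsub hP' =>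
    hP'.image_of_continuousOn_injOn continuous_fst.continuousOn (hinj.mono hsub)
  have hdom : {a | ApproxDifferentiableAt μ f a} = Prod.fst '' P := by
    ext a
    rw [Set.mem_ofPred_eq, approxDifferentiableAt_iff hf]
    constructor
    · rintro ⟨A, hA⟩
      obtain ⟨T, rfl⟩ := hA.exists_affineTuple hS hfS
      exact ⟨(a, T), hA, rfl⟩
    · rintro ⟨⟨a, T⟩, hT, rfl⟩
      exact ⟨_, hT⟩
  have hdomm : MeasurableSet {a | ApproxDifferentiableAt μ f a} := by
    rw [hdom]
    exact himage P subset_rfl hP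
  refine ⟨hdomm, fun O hO => ?_⟩
  let D : Sym (S × (X →L[ℝ] S)) Q → Sym (X →L[ℝ] Y) Q := fun T =>
    T.map fun p => S.subtypeₗᵢ.toContinuousLinearMap.comp p.2
  have hD : Continuous D := continuous_map_comp S.subtypeₗᵢ
  have hval : ∀ p ∈ P, approxDeriv μ f p.1 = D p.2 := fun p hp => by
    rw [approxDeriv, TangentAt.approxAffine_eq hf hp]
    exact map_linear_affineTuple _ _ _
  have hpre : approxDeriv μ f ⁻¹' O = Prod.fst '' (P ∩ (fun p => D p.2) ⁻¹' O) ∪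
      ({a | ApproxDifferentiableAt μ f a}ᶜ ∩ {_a | (Sym.replicate Q (0 : X →ᵃ[ℝ] Y)).map
        (fun A => LinearMap.toContinuousLinearMap A.linear) ∈ O}) := by
    ext a
    by_cases ha : ApproxDifferentiableAt μ f a
    · have ha' : a ∈ Prod.fst '' P := hdom ▸ ha
      constructor
      · intro h
        obtain ⟨p, hp, rfl⟩ := ha'
        exact Or.inl ⟨p, ⟨hp, (hval p hp ▸ h : D p.2 ∈ O)⟩, rfl⟩
      · rintro (⟨p, ⟨hp, hpO⟩, rfl⟩ | h)
        · exact (hval p hp ▸ hpO : approxDeriv μ f p.1 ∈ O)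
        · exact absurd ha h.1
    · have hrep : approxDeriv μ f a = (Sym.replicate Q (0 : X →ᵃ[ℝ] Y)).map
          (fun A => LinearMap.toContinuousLinearMap A.linear) := by
        rw [approxDeriv, approxAffine, dif_neg ha]
      constructor
      · intro h
        have h' : approxDeriv μ f a ∈ O := h
        rw [hrep] at h'
        exact Or.inr ⟨ha, h'⟩
      · rintro (⟨p, ⟨hp, -⟩, rfl⟩ | h)
        · exact absurd ((approxDifferentiableAt_iff hf).2 ⟨_, hp⟩) ha
        · exact (hrep ▸ h.2 : approxDeriv μ f a ∈ O)
  rw [hpre]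
  refine (himage _ Set.inter_subset_left (hP.inter ?_)).union (hdomm.compl.inter
    (MeasurableSet.const _))
  exact (hD.comp continuous_snd).measurable hO

end Measurability

/-! ### Lipschitz curves and arc length -/

section Curves

/-- The distance of the end points of a Lipschitz curve in a metric space is at most the integral
of any almost everywhere upper bound for its metric derivative. -/
theorem dist_le_integral_of_metricDeriv_le {Z : Type*} [PseudoMetricSpace Z] {h : ℝ → Z} {C : ℝ≥0}
    {a b : ℝ} (hab : a ≤ b) (hh : LipschitzOnWith C h (Set.Icc a b)) {w : ℝ → ℝ}
    (hw : IntegrableOn w (Set.Icc a b)) (hw0 : ∀ t, 0 ≤ w t)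
    (hd : ∀ᵐ t ∂volume.restrict (Set.Icc a b), ∀ c, w t < c →
      ∀ᶠ s in 𝓝 t, dist (h s) (h t) ≤ c * |s - t|) :
    dist (h b) (h a) ≤ ∫ t in Set.Icc a b, w t := by
  have hu : LipschitzOnWith C (fun s => dist (h s) (h a)) (Set.Icc a b) := by
    have := (LipschitzWith.dist_left (h a)).comp_lipschitzOnWith hh
    rwa [one_mul] at this
  have hac : AbsolutelyContinuousOnInterval (fun s => dist (h s) (h a)) a b :=
    LipschitzOnWith.absolutelyContinuousOnInterval (by rwa [Set.uIcc_of_le hab])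
  have h1 := hac.integral_deriv_eq_sub
  rw [dist_self, sub_zero] at h1
  rw [← h1, intervalIntegral.integral_of_le hab, ← integral_Icc_eq_integral_Ioc]
  have hint : IntegrableOn (deriv fun s => dist (h s) (h a)) (Set.Icc a b) := by
    rw [integrableOn_Icc_iff_integrableOn_Ioc, ← intervalIntegrable_iff_integrableOn_Ioc_of_le hab]
    exact hac.intervalIntegrable_deriv
  refine integral_mono_ae hint hw ?_
  filter_upwards [hd] with t ht
  refine (Real.le_norm_self _).trans (le_of_forall_gt_imp_ge_of_dense fun c hc => ?_)
  refine norm_deriv_le_of_lip' (𝕜 := ℝ) (f := fun s => dist (h s) (h a)) ((hw0 t).trans hc.le) ?_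
  filter_upwards [ht c hc] with s hs
  exact (abs_dist_sub_le _ _ _).trans hs

/-- The trace of a curve is at least as long as the distance of its end points: the distance from
one of them maps the trace onto a set containing an interval. -/
theorem edist_le_hausdorffMeasure_image {X : Type*} [MetricSpace X] [MeasurableSpace X]
    [BorelSpace X] {γ : ℝ → X} {s t : ℝ} (hst : s ≤ t)
    (hγ : ContinuousOn γ (Set.Icc s t)) :
    edist (γ t) (γ s) ≤ Measure.hausdorffMeasure 1 (γ '' Set.Icc s t) := by
  have h1 := (LipschitzWith.dist_left (γ s)).hausdorffMeasure_image_le zero_le_one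
    (γ '' Set.Icc s t)
  rw [hausdorffMeasure_real, ENNReal.coe_one, ENNReal.one_rpow, one_mul] at h1
  refine le_trans ?_ h1
  have h2 : Set.Icc 0 (dist (γ t) (γ s)) ⊆ (fun x => dist x (γ s)) '' (γ '' Set.Icc s t) := by
    rw [Set.image_image]
    have := intermediate_value_Icc hst
      ((continuous_id.dist (continuous_const (y := γ s))).comp_continuousOn hγ)
    simp only [Function.comp_apply, id_eq] at this
    rwa [dist_self] at this
  refine le_trans (le_of_eq ?_) (measure_mono h2)
  rw [Real.volume_Icc, sub_zero, edist_dist]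

variable {X : Type*} [NormedAddCommGroup X] [NormedSpace ℝ X]

theorem eventually_norm_sub_le_of_norm_deriv_eq_one {γ : ℝ → X} {t : ℝ} (ht : ‖deriv γ t‖ = 1)
    {c : ℝ} (hc : 1 < c) : ∀ᶠ s in 𝓝 t, dist (γ s) (γ t) ≤ c * |s - t| := by
  have hdiff : DifferentiableAt ℝ γ t := by
    by_contra h
    simp [deriv_zero_of_not_differentiableAt h] at ht
  have := hdiff.hasDerivAt.isLittleO.def (sub_pos.2 hc)
  filter_upwards [this] with s hs
  rw [Real.norm_eq_abs] at hs
  have h1 := norm_add_le (γ s - γ t - (s - t) • deriv γ t) ((s - t) • deriv γ t)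
  rw [sub_add_cancel, norm_smul, ht, mul_one, Real.norm_eq_abs] at h1
  rw [dist_eq_norm]
  linarith

/-- A curve which has unit speed almost everywhere is `1`-Lipschitz. -/
theorem lipschitzOnWith_one_of_unit_speed {γ : ℝ → X} {C : ℝ≥0}
    (hγ : LipschitzOnWith C γ (Set.Icc 0 1))
    (hd : ∀ᵐ t ∂volume.restrict (Set.Icc (0 : ℝ) 1), ‖deriv γ t‖ = 1) :
    LipschitzOnWith 1 γ (Set.Icc 0 1) := by
  refine LipschitzOnWith.of_dist_le_mul fun t ht s hs => ?_
  wlog hst : s ≤ t generalizing s t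
  · rw [dist_comm, dist_comm t]
    exact this s hs t ht (le_of_not_ge hst)
  have hsub : Set.Icc s t ⊆ Set.Icc 0 1 := Set.Icc_subset_Icc hs.1 ht.2
  have := dist_le_integral_of_metricDeriv_le hst (hγ.mono hsub) (w := fun _ => 1) (by simp)
    (fun _ => zero_le_one) (by
      filter_upwards [ae_restrict_of_ae_restrict_of_subset hsub hd] with r hr c hc
      exact eventually_norm_sub_le_of_norm_deriv_eq_one hr hc)
  refine this.trans (le_of_eq ?_)
  rw [Real.dist_eq, abs_of_nonneg (sub_nonneg.2 hst)]
  simp [hst]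

variable [MeasurableSpace X] [BorelSpace X]

/-- An injective curve of unit speed has length at least one. The length of its initial segments is
a Lipschitz function whose derivative is at least one almost everywhere. -/
theorem one_le_hausdorffMeasure_image {γ : ℝ → X} (hinj : Set.InjOn γ (Set.Icc 0 1))
    (hγ : LipschitzOnWith 1 γ (Set.Icc 0 1))
    (hd : ∀ᵐ t ∂volume.restrict (Set.Icc (0 : ℝ) 1), ‖deriv γ t‖ = 1) :
    1 ≤ Measure.hausdorffMeasure 1 (γ '' Set.Icc 0 1) := by
  have : NullSingletonClass (Measure.hausdorffMeasure 1 : Measure X) :=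
    Measure.nullSingletonClass_hausdorff X one_pos
  set H : Set X → ℝ≥0∞ := fun A => Measure.hausdorffMeasure 1 A with hH
  have hle : ∀ E ⊆ Set.Icc (0 : ℝ) 1, H (γ '' E) ≤ volume E := fun E hE => by
    have := (hγ.mono hE).hausdorffMeasure_image_le zero_le_one
    rwa [hausdorffMeasure_real, ENNReal.coe_one, ENNReal.one_rpow, one_mul] at this
  have hfin : ∀ E ⊆ Set.Icc (0 : ℝ) 1, H (γ '' E) ≠ ∞ := fun E hE =>
    ((hle E hE).trans_lt ((measure_mono hE).trans_lt (by simp))).ne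
  set g : ℝ → ℝ := fun t => (H (γ '' Set.Icc 0 t)).toReal with hg
  have hsplit : ∀ s t, 0 ≤ s → s ≤ t → t ≤ 1 → g t - g s = (H (γ '' Set.Ioc s t)).toReal := by
    intro s t h0 hst h1
    have hU : γ '' Set.Icc 0 t = γ '' Set.Icc 0 s ∪ γ '' Set.Ioc s t := by
      rw [← Set.image_union, Set.Icc_union_Ioc_eq_Icc h0 hst]
    have hs1 : Set.Icc 0 s ⊆ Set.Icc (0 : ℝ) 1 := Set.Icc_subset_Icc_right (hst.trans h1)
    have ht1 : Set.Ioc s t ⊆ Set.Icc (0 : ℝ) 1 := fun r hr => ⟨h0.trans hr.1.le, hr.2.trans h1⟩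
    have hdisj : Disjoint (γ '' Set.Ioc s t) (γ '' Set.Icc 0 s) :=
      Set.disjoint_image_image fun r hr r' hr' h =>
        hr.1.not_ge (hinj (ht1 hr) (hs1 hr') h ▸ hr'.2)
    have hmeas : MeasurableSet (γ '' Set.Icc 0 s) :=
      (isCompact_Icc.image_of_continuousOn (hγ.continuousOn.mono hs1)).isClosed.measurableSet
    have h2 : H (γ '' Set.Icc 0 t) = H (γ '' Set.Ioc s t) + H (γ '' Set.Icc 0 s) := by
      rw [hU, Set.union_comm]
      exact measure_union hdisj hmeas
    simp only [hg]
    rw [h2, ENNReal.toReal_add (hfin _ ht1) (hfin _ hs1)]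
    ring
  have hlow : ∀ s t, 0 ≤ s → s ≤ t → t ≤ 1 → ‖γ t - γ s‖ ≤ g t - g s := by
    intro s t h0 hst h1
    have ht1 : Set.Ioc s t ⊆ Set.Icc (0 : ℝ) 1 := fun r hr => ⟨h0.trans hr.1.le, hr.2.trans h1⟩
    have ht2 : Set.Icc s t ⊆ Set.Icc (0 : ℝ) 1 := Set.Icc_subset_Icc h0 h1
    have h2 := edist_le_hausdorffMeasure_image hst (hγ.continuousOn.mono ht2)
    have h3 : Measure.hausdorffMeasure 1 (γ '' Set.Icc s t) ≤ H (γ '' Set.Ioc s t) := by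
      rw [← Set.Ioc_insert_left hst, Set.image_insert_eq]
      exact (measure_congr (insert_ae_eq_self _ _)).le
    rw [hsplit s t h0 hst h1, ← dist_eq_norm, dist_edist]
    exact ENNReal.toReal_mono (hfin _ ht1) (h2.trans h3)
  have hgL : LipschitzOnWith 1 g (Set.Icc 0 1) := by
    refine LipschitzOnWith.of_dist_le_mul fun t ht s hs => ?_
    wlog hst : s ≤ t generalizing s t
    · rw [dist_comm, dist_comm t]
      exact this s hs t ht (le_of_not_ge hst)
    have ht1 : Set.Ioc s t ⊆ Set.Icc (0 : ℝ) 1 := fun r hr => ⟨hs.1.trans hr.1.le, hr.2.trans ht.2⟩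
    have h2 := hsplit s t hs.1 hst ht.2
    have h3 := ENNReal.toReal_mono (by simp) (hle _ ht1)
    rw [Real.volume_Ioc, ENNReal.toReal_ofReal (sub_nonneg.2 hst)] at h3
    rw [Real.dist_eq, Real.dist_eq, h2, abs_of_nonneg ENNReal.toReal_nonneg,
      abs_of_nonneg (sub_nonneg.2 hst), NNReal.coe_one, one_mul]
    exact h3
  have hac : AbsolutelyContinuousOnInterval g 0 1 :=
    LipschitzOnWith.absolutelyContinuousOnInterval (by rwa [Set.uIcc_of_le zero_le_one])
  have hint : IntegrableOn (deriv g) (Set.Ioc 0 1) :=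
    (intervalIntegrable_iff_integrableOn_Ioc_of_le zero_le_one).1 hac.intervalIntegrable_deriv
  have hderiv : ∀ᵐ t ∂volume.restrict (Set.Ioc (0 : ℝ) 1), 1 ≤ deriv g t := by
    have hne : ∀ᵐ t ∂volume.restrict (Set.Ioc (0 : ℝ) 1), t ≠ 1 :=
      ae_restrict_of_ae (by simp [ae_iff])
    have hmem : ∀ᵐ t ∂volume.restrict (Set.Ioc (0 : ℝ) 1), t ∈ Set.Ioc (0 : ℝ) 1 :=
      ae_restrict_mem measurableSet_Ioc
    filter_upwards [ae_restrict_of_ae_restrict_of_subset Set.Ioc_subset_Icc_self hd,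
      ae_restrict_of_ae hac.ae_differentiableAt, hne, hmem] with t h1 h2 h3 h4
    have h5 : t < 1 := lt_of_le_of_ne h4.2 h3
    have hγd : DifferentiableAt ℝ γ t := by
      by_contra h
      simp [deriv_zero_of_not_differentiableAt h] at h1
    have hgd : DifferentiableAt ℝ g t := h2 (by
      rw [Set.uIcc_of_le zero_le_one]
      exact Set.Ioc_subset_Icc_self h4)
    have hsub : 𝓝[>] t ≤ 𝓝[≠] t := nhdsWithin_mono _ fun s hs => (ne_of_gt hs)
    have h6 := ((hasDerivAt_iff_tendsto_slope.1 hγd.hasDerivAt).mono_left hsub).norm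
    have h7 := (hasDerivAt_iff_tendsto_slope.1 hgd.hasDerivAt).mono_left hsub
    rw [h1] at h6
    refine le_of_tendsto_of_tendsto h6 h7 ?_
    filter_upwards [Ioo_mem_nhdsGT h5] with s hs
    have h8 : 0 < s - t := sub_pos.2 hs.1
    rw [slope_def_module, slope_def_module, norm_smul, norm_inv, Real.norm_of_nonneg h8.le,
      smul_eq_mul]
    exact mul_le_mul_of_nonneg_left (hlow t s h4.1.le hs.1.le hs.2.le) (inv_nonneg.2 h8.le)
  have hone : (1 : ℝ) ≤ g 1 - g 0 := by
    rw [← hac.integral_deriv_eq_sub, intervalIntegral.integral_of_le zero_le_one]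
    have := integral_mono_ae (integrable_const (1 : ℝ)) hint hderiv
    simpa using this
  have hg0 : 0 ≤ g 0 := ENNReal.toReal_nonneg
  have hg1 : 1 ≤ (H (γ '' Set.Icc 0 1)).toReal := by
    change 1 ≤ g 1
    linarith
  rw [← ENNReal.toReal_le_toReal ENNReal.one_ne_top (hfin _ subset_rfl)]
  simpa using hg1

/-- The area formula for an injective curve of unit speed. -/
theorem map_restrict_eq_hausdorffMeasure {γ : ℝ → X} (hinj : Set.InjOn γ (Set.Icc 0 1))
    (hγ : LipschitzOnWith 1 γ (Set.Icc 0 1))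
    (hd : ∀ᵐ t ∂volume.restrict (Set.Icc (0 : ℝ) 1), ‖deriv γ t‖ = 1) :
    Measure.map γ (volume.restrict (Set.Icc 0 1)) =
      (Measure.hausdorffMeasure 1).restrict (γ '' Set.Icc 0 1) := by
  have hm : AEMeasurable γ (volume.restrict (Set.Icc 0 1)) :=
    hγ.continuousOn.aemeasurable measurableSet_Icc
  symm
  have hle : (Measure.hausdorffMeasure 1).restrict (γ '' Set.Icc 0 1) ≤
      Measure.map γ (volume.restrict (Set.Icc 0 1)) := by
    refine Measure.le_intro fun B hB _ => ?_
    rw [Measure.map_apply_of_aemeasurable hm hB, Measure.restrict_apply hB,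
      Measure.restrict_apply' measurableSet_Icc, Set.inter_comm, ← Set.image_inter_preimage,
      Set.inter_comm]
    have := (hγ.mono Set.inter_subset_right :
      LipschitzOnWith 1 γ (γ ⁻¹' B ∩ Set.Icc 0 1)).hausdorffMeasure_image_le zero_le_one
    rwa [hausdorffMeasure_real, ENNReal.coe_one, ENNReal.one_rpow, one_mul] at this
  have hfin : IsFiniteMeasure ((Measure.hausdorffMeasure 1).restrict (γ '' Set.Icc 0 1)) :=
    isFiniteMeasure_of_le _ hle
  refine Measure.eq_of_le_of_measure_univ_eq hle (le_antisymm (hle _) ?_)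
  rw [Measure.map_apply_of_aemeasurable hm MeasurableSet.univ, Measure.restrict_apply_univ]
  simpa using one_le_hausdorffMeasure_image hinj hγ hd

end Curves

/-! ### Variation along curves -/

section Variation

variable {X : Type*} [NormedAddCommGroup X] [NormedSpace ℝ X] [FiniteDimensional ℝ X]
  [MeasurableSpace X] [BorelSpace X] {μ : Measure X} [μ.IsAddHaarMeasure]
  {Y : Type*} [NormedAddCommGroup Y] [NormedSpace ℝ Y] {Q : ℕ}

theorem tupleNorm_approxDeriv_le {f : X → Sym Y Q} {K : ℝ≥0} (hf : LipschitzWith K f) (a : X) :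
    tupleNorm (approxDeriv μ f a) ≤ √(Q : ℝ) * K := by
  by_cases h : ApproxDifferentiableAt μ f a
  · exact (tangentAt_approxAffine hf h).tupleNorm_le hf
  · rw [approxDeriv, approxAffine, dif_neg h]
    rw [← ofFn_const, map_ofFn, tupleNorm_ofFn]
    simp only [Function.comp_apply, AffineMap.zero_linear, map_zero, norm_zero]
    simp only [ne_eq, OfNat.ofNat_ne_zero, not_false_eq_true, zero_pow, Finset.sum_const_zero,
      Real.sqrt_zero]
    positivity

/-- The metric derivative of `f ∘ γ` is bounded by `|Df|` along a unit speed curve `γ`. -/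
theorem eventually_dist_comp_curve_le {f : X → Sym Y Q} {K : ℝ≥0} (hf : LipschitzWith K f)
    {γ : ℝ → X} {t : ℝ} (ht : ‖deriv γ t‖ = 1) (hfγ : ApproxDifferentiableAt μ f (γ t)) {c : ℝ}
    (hc : tupleNorm (approxDeriv μ f (γ t)) < c) :
    ∀ᶠ s in 𝓝 t, dist (f (γ s)) (f (γ t)) ≤ c * |s - t| := by
  set F := tupleNorm (approxDeriv μ f (γ t)) with hF
  have hF0 : 0 ≤ F := tupleNorm_nonneg _
  have hA := tangentAt_approxAffine hf hfγ
  obtain ⟨ε, hε, hεc⟩ : ∃ ε : ℝ, 0 < ε ∧ (F + ε) * (1 + ε) < c := by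
    have hcont : Continuous fun ε : ℝ => (F + ε) * (1 + ε) := by fun_prop
    obtain ⟨ε, h1, h2⟩ := ((((hcont.tendsto 0).mono_left nhdsWithin_le_nhds).eventually
      (gt_mem_nhds (show (F + 0) * (1 + 0) < c by simpa using hc))).and
        (self_mem_nhdsWithin (s := Set.Ioi (0 : ℝ)))).exists
    exact ⟨ε, h2, h1⟩
  have hγc : ContinuousAt γ t := by
    by_contra h
    have h' : ¬ DifferentiableAt ℝ γ t := fun h' => h h'.continuousAt
    simp [deriv_zero_of_not_differentiableAt h'] at ht
  filter_upwards [hγc.eventually (hA ε hε),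
    eventually_norm_sub_le_of_norm_deriv_eq_one ht (show 1 < 1 + ε by linarith)] with s h1 h2
  have h3 := dist_evalAffine_le (approxAffine μ f (γ t)) (γ t) (γ s - γ t)
  rw [add_sub_cancel, hA.evalAffine_self] at h3
  change _ ≤ F * _ at h3
  rw [← dist_eq_norm] at h1 h3
  have h4 := dist_triangle (f (γ s)) (evalAffine (approxAffine μ f (γ t)) (γ s)) (f (γ t))
  have h5 : (F + ε) * dist (γ s) (γ t) ≤ (F + ε) * ((1 + ε) * |s - t|) :=
    mul_le_mul_of_nonneg_left h2 (by positivity)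
  have h6 : (F + ε) * (1 + ε) * |s - t| ≤ c * |s - t| :=
    mul_le_mul_of_nonneg_right hεc.le (abs_nonneg _)
  linarith

theorem integrableOn_and_dist_le_integral [CompleteSpace Y] {f : X → Sym Y Q} {K : ℝ≥0}
    (hf : LipschitzWith K f) {γ : ℝ → X} {C : ℝ≥0} (hinj : Set.InjOn γ (Set.Icc 0 1))
    (hγ : LipschitzOnWith C γ (Set.Icc 0 1))
    (hd : ∀ᵐ t ∂volume.restrict (Set.Icc (0 : ℝ) 1),
      ‖deriv γ t‖ = 1 ∧ ApproxDifferentiableAt μ f (γ t)) :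
    IntegrableOn (fun x => tupleNorm (approxDeriv μ f x)) (γ '' Set.Icc 0 1)
        (Measure.hausdorffMeasure 1) ∧
      dist (f (γ 1)) (f (γ 0)) ≤ ∫ x in γ '' Set.Icc 0 1, tupleNorm (approxDeriv μ f x)
        ∂Measure.hausdorffMeasure 1 := by
  have hd1 : ∀ᵐ t ∂volume.restrict (Set.Icc (0 : ℝ) 1), ‖deriv γ t‖ = 1 := hd.mono fun t h => h.1
  have hγ1 := lipschitzOnWith_one_of_unit_speed hγ hd1
  have hmap := map_restrict_eq_hausdorffMeasure hinj hγ1 hd1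
  have hm : AEMeasurable γ (volume.restrict (Set.Icc 0 1)) :=
    hγ.continuousOn.aemeasurable measurableSet_Icc
  have hFm : Measurable fun x => tupleNorm (approxDeriv μ f x) :=
    (continuous_id.dist continuous_const).measurable.comp (measurable_approxDeriv μ hf).2
  have hint : Integrable (fun x => tupleNorm (approxDeriv μ f x))
      (Measure.map γ (volume.restrict (Set.Icc 0 1))) := by
    have : IsFiniteMeasure (Measure.map γ (volume.restrict (Set.Icc (0 : ℝ) 1))) := inferInstance
    refine Integrable.of_bound hFm.aestronglyMeasurable (√(Q : ℝ) * K)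
      (Eventually.of_forall fun x => ?_)
    rw [Real.norm_of_nonneg (tupleNorm_nonneg _)]
    exact tupleNorm_approxDeriv_le hf x
  refine ⟨?_, ?_⟩
  · rwa [hmap] at hint
  · rw [← hmap, integral_map hm hFm.aestronglyMeasurable]
    refine dist_le_integral_of_metricDeriv_le zero_le_one (h := f ∘ γ)
      (hf.comp_lipschitzOnWith hγ) (hint.comp_aemeasurable hm)
      (fun t => tupleNorm_nonneg _) ?_
    filter_upwards [hd] with t ht c hc
    exact eventually_dist_comp_curve_le hf ht.1 ht.2 hc

end Variation

end QValued

theorem theorem258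
    {X : Type*} [NormedAddCommGroup X] [NormedSpace ℝ X] [FiniteDimensional ℝ X]
    [MeasurableSpace X] [BorelSpace X] (μ : Measure X) [μ.IsAddHaarMeasure]
    {Y : Type*} [NormedAddCommGroup Y] [NormedSpace ℝ Y] [CompleteSpace Y]
    (hY : QValued.RadonNikodymProperty Y)
    {Q : ℕ} (hQ : 0 < Q) (f : X → Sym Y Q) (K : ℝ≥0) (hf : LipschitzWith K f) :
    -- (A) unambiguous approximate differentiability almost everywhere
    (∀ᵐ a ∂μ, QValued.UnambiguouslyApproxDifferentiableAt μ f a ∧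
      QValued.evalAffine (QValued.approxAffine μ f a) a = f a) ∧
    -- (B) Borel measurability of the derivative (and of its domain)
    (MeasurableSet {a | QValued.ApproxDifferentiableAt μ f a} ∧
      Measurable (QValued.approxDeriv μ f)) ∧
    -- (C) approximate differentiability implies differentiability, with a bound on the derivative
    (∀ a, QValued.ApproxDifferentiableAt μ f a →
      Tendsto (fun x => dist (f x) (QValued.evalAffine (QValued.approxAffine μ f a) x) / ‖x - a‖)
        (𝓝[≠] a) (𝓝 0) ∧
      QValued.tupleNorm (QValued.approxDeriv μ f a) ≤ √(Q : ℝ) * K) ∧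
    -- (D) the variation of `f` along unit speed curves is controlled by the derivative
    (∀ (γ : ℝ → X) (C : ℝ≥0), Set.InjOn γ (Set.Icc 0 1) → LipschitzOnWith C γ (Set.Icc 0 1) →
      (∀ᵐ t ∂(volume.restrict (Set.Icc (0 : ℝ) 1)),
        ‖deriv γ t‖ = 1 ∧ QValued.ApproxDifferentiableAt μ f (γ t)) →
      IntegrableOn (fun x => QValued.tupleNorm (QValued.approxDeriv μ f x))
        (γ '' Set.Icc 0 1) (Measure.hausdorffMeasure 1) ∧
      dist (f (γ 1)) (f (γ 0)) ≤
        ∫ x in γ '' Set.Icc 0 1, QValued.tupleNorm (QValued.approxDeriv μ f x)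
          ∂(Measure.hausdorffMeasure 1)) := by
  refine ⟨?_, QValued.measurable_approxDeriv μ hf, fun a ha => ?_, fun γ C hinj hγ hd =>
    QValued.integrableOn_and_dist_le_integral hf hinj hγ hd⟩
  · filter_upwards [hY.ae_unambiguouslyApproxDifferentiableAt (μ := μ) hf] with a ha
    exact ⟨ha, (QValued.tangentAt_approxAffine hf ha.1).evalAffine_self⟩
  · have hA := QValued.tangentAt_approxAffine hf ha
    refine ⟨Metric.tendsto_nhds.2 fun ε hε => ?_, hA.tupleNorm_le hf⟩
    filter_upwards [(hA (ε / 2) (half_pos hε)).filter_mono nhdsWithin_le_nhds,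
      self_mem_nhdsWithin] with x hx hxa
    have h0 : 0 < ‖x - a‖ := norm_pos_iff.2 (sub_ne_zero.2 hxa)
    rw [Real.dist_0_eq_abs, abs_of_nonneg (by positivity), div_lt_iff₀ h0]
    nlinarith [mul_pos hε h0]
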